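/- **Theorem (Pieri rule for $S_n$).** All representations are over $\mathbb{C}$. For a Young diagram $D$ with $n$ boxes and rows $d_1\ge d_2\ge\dots\ge d_r$, let $S_D\cong S_{d_1}\times\dots\times S_{d_r}$ be the subgroup of $S_n$ preserving the set of the first $d_1$ letters, the set of the next $d_2$ letters, and so on. Put $Y_D=\mathrm{Ind}_{S_D}^{S_n}(\mathbf 1)$ and $Y_D(\mathrm{sgn})=\mathrm{Ind}_{S_D}^{S_n}(\mathrm{sgn}|_{S_D})$, and let $\sigma_D$ be the joint component of $Y_{D^t}(\mathrm{sgn})$ and $Y_D$, where $D^t$ is the transposed diagram; that is, $\sigma_D\subset Y_D$ is the sum of the images of all intertwining maps $Y_{D^t}(\mathrm{sgn})\to Y_D$. Let $0\le k\le n$, and let $S_k\times S_{n-k}\subset S_n$, where $S_k$ permutes the first $k$ letters and $S_{n-k}$ the last $n-k$ letters. Let $D$ be a Young diagram with $k$ boxes. Then $\sigma_D$ is irreducible, the representations $\sigma_E$ of $S_n$, for Young diagrams $E$ with $n$ boxes, are irreducible and pairwise non-isomorphic, and the induced representation $$I_{\sigma_D}=\mathrm{Ind}_{S_k\times S_{n-k}}^{S_n}(\sigma_D\otimes\mathbf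 1_{n-k})$$ is multiplicity-free, i.e. $\dim\mathrm{Hom}_{S_n}(\tau,I_{\sigma_D})\le 1$ for every irreducible representation $\tau$ of $S_n$. Moreover $$I_{\sigma_D}\;\cong\;\bigoplus_E \sigma_E,$$ where $E$ runs, each taken once, through all Young diagrams with $n$ boxes such that 1. $D\subset E$; and 2. $E-D$ is a horizontal $(n-k)$-strip, i.e. $E-D$ has $n-k$ boxes and each column of $E$ is at most one box longer than the corresponding column of $D$. -/

import Mathlib

open scoped Pointwise

namespace PieriSn

/-! ### Young diagrams -/

/-- Young diagrams with `n` boxes. -/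
abbrev Diagram (n : ℕ) : Type := {D : YoungDiagram // D.card = n}

theorem card_transpose (D : YoungDiagram) : D.transpose.card = D.card := 
  Finset.card_map (Equiv.prodComm ℕ ℕ).toEmbedding

/-- The transposed diagram `Dᵗ`. -/
def Diagram.transpose {n : ℕ} (D : Diagram n) : Diagram n :=
  ⟨D.1.transpose, (card_transpose D.1).trans D.2⟩

/-- `D ⊂ E` and `E - D` is a horizontal `m`-strip: `E - D` has `m` boxes and each column of `E` is
at most one box longer than the corresponding column of `D`. -/
def IsHorizontalStrip (D E : YoungDiagram) (m : ℕ) : Prop :=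
  D ≤ E ∧ (E.cells \ D.cells).card = m ∧ ∀ j : ℕ, E.colLen j ≤ D.colLen j + 1

/-! ### Young modules and the irreducible representations of the symmetric group -/

/-- The rows of the standard tabloid of shape `D`: the first row contains the first `d₁` elements
of `Fin n`, the second row the next `d₂` elements, and so on. -/
def tabloidRow {n : ℕ} (D : Diagram n) (r : ℕ) : Set (Fin n) :=
  {i | ∑ j ∈ Finset.range r, D.1.rowLen j ≤ (i : ℕ) ∧
    (i : ℕ) < ∑ j ∈ Finset.range (r + 1), D.1.rowLen j}

/-- The Young subgroup `S_D` of `S_n`: the stabilizer of the standard tabloid, that is, the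
permutations that map each of its rows to itself. -/
def youngSubgroup {n : ℕ} (D : Diagram n) : Subgroup (Equiv.Perm (Fin n)) :=
  ⨅ r : ℕ, MulAction.stabilizer (Equiv.Perm (Fin n)) (tabloidRow D r)

/-- The sign representation of `S_n`, on `ℂ`. -/
noncomputable def sgn (n : ℕ) : Representation ℂ (Equiv.Perm (Fin n)) ℂ where
  toFun g := ((Equiv.Perm.sign g : ℤ) : ℂ) • LinearMap.id
  map_one' := by ext; simp
  map_mul' g h := by ext; simp [mul_comm]

/-- The Young module `Y_D`, induced to `S_n` from the trivial representation of `S_D`. -/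
noncomputable abbrev youngModule {n : ℕ} (D : Diagram n) :=
  Representation.ind (youngSubgroup D).subtype (Representation.trivial ℂ (youngSubgroup D) ℂ)

/-- The twisted Young module `Y_D(sgn)`, induced to `S_n` from the restriction of the sign
representation to `S_D`. -/
noncomputable abbrev twistedYoungModule {n : ℕ} (D : Diagram n) :=
  Representation.ind (youngSubgroup D).subtype ((sgn n).comp (youngSubgroup D).subtype)

/-- The joint component of `Y_{Dᵗ}(sgn)` and `Y_D`, as a subrepresentation of `Y_D`: the sum of
the images of all intertwining maps `Y_{Dᵗ}(sgn) → Y_D`. By complete reducibility this is the sum of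
all irreducible subrepresentations of `Y_D` that also occur in `Y_{Dᵗ}(sgn)`. -/
noncomputable def jointComponent {n : ℕ} (D : Diagram n) : Subrepresentation (youngModule D) where
  toSubmodule := ⨆ f : Representation.IntertwiningMap (twistedYoungModule D.transpose)
    (youngModule D), f.range.toSubmodule
  apply_mem_toSubmodule g v hv := by
    have h : (⨆ f : Representation.IntertwiningMap (twistedYoungModule D.transpose)
        (youngModule D), f.range.toSubmodule) ≤
        (⨆ f : Representation.IntertwiningMap (twistedYoungModule D.transpose)
        (youngModule D), f.range.toSubmodule).comap (youngModule D g) :=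
      iSup_le fun f w hw =>
        Submodule.mem_iSup_of_mem f (f.range.apply_mem_toSubmodule g hw)
    exact h hv

/-- The representation `σ_D` of `S_n` attached to the diagram `D` with `n` boxes. -/
noncomputable abbrev sigma {n : ℕ} (D : Diagram n) :=
  (jointComponent D).toRepresentation

/-! ### The induced representation -/

/-- The standard embedding `S_k × S_m → S_{k+m}`: the first factor permutes the first `k` letters,
the second factor permutes the last `m` letters. -/
def prodEmbedding (k m : ℕ) :
    Equiv.Perm (Fin k) × Equiv.Perm (Fin m) →* Equiv.Perm (Fin (k + m)) :=
  (finSumFinEquiv.permCongrHom.toMonoidHom).comp (Equiv.Perm.sumCongrHom (Fin k) (Fin m))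

/-- The representation `σ_D ⊗ 1` of `S_k × S_m` (external tensor product with the trivial
representation of `S_m`). -/
noncomputable abbrev sigmaTensorTrivial {k : ℕ} (D : Diagram k) (m : ℕ) :=
  Representation.tprod
    ((sigma D).comp (MonoidHom.fst (Equiv.Perm (Fin k)) (Equiv.Perm (Fin m))))
    ((Representation.trivial ℂ (Equiv.Perm (Fin m)) ℂ).comp
      (MonoidHom.snd (Equiv.Perm (Fin k)) (Equiv.Perm (Fin m))))

/-- `Ind_{S_k × S_m}^{S_{k+m}} (σ_D ⊗ 1)`. -/
noncomputable abbrev pieriInd {k : ℕ} (D : Diagram k) (m : ℕ) :=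
  Representation.ind (prodEmbedding k m) (sigmaTensorTrivial D m)

/-- A complex representation `ρ` is multiplicity-free if every irreducible representation `τ`
occurs in it at most once, i.e. `dim Hom(τ, ρ) ≤ 1`. -/
def IsMultiplicityFree {G V : Type} [Group G] [AddCommGroup V] [Module ℂ V]
    (ρ : Representation ℂ G V) : Prop :=
  ∀ (W : Type) [AddCommGroup W] [Module ℂ W] (τ : Representation ℂ G W), τ.IsIrreducible →
    Module.rank ℂ (Representation.IntertwiningMap τ ρ) ≤ 1

end PieriSn

/-!
The proof works with real class functions on symmetric groups and their normalised inner product,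
which computes dimensions of spaces of intertwining maps (`ip_chr`); all characters of `S_n` are
real because every permutation is conjugate to its inverse.

*Young modules.* The character of `Y_D` counts the colourings of `n` letters, with `rowLen i`
letters of colour `i`, that are fixed by a permutation (`chr_youngModule`), and `Y_D(sgn)` has the
same character times the sign. Induction `V ↦ Ind (V ⊗ 1)` adds a new colour (`pieriMap_permChar`),
restriction splits a colouring into two (`permChar_prodEmbedding`). By Frobenius reciprocity this
gives recursions for the inner products: `⟨Y_D, Y_E⟩` counts matrices over `ℕ`, and
`⟨Y_D(sgn), Y_E⟩` counts `0`-`1` matrices, with the row lengths of `D` and `E` as margins.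

*The representations `σ_D`.* Let the weight of a diagram be the sum of the row indices of its boxes.
For the pairing of `Y_{Eᵗ}(sgn)` with `Y_F`, the `0`-`1` matrices have the column lengths of `E` as
one margin, so they force the weight of `F` to be at least that of `E`, with equality only for the
diagram of `E` itself (`ip_sgn_permChar_permChar`). Hence there is exactly one intertwining map
`Y_{Eᵗ}(sgn) → Y_E` up to scalars, its image `σ_E` is irreducible (`isIrreducible_range`), and the
`σ_E` are pairwise non-isomorphic.

*Young's rule.* Adding and removing horizontal strips satisfy the same commutation rule as induction
and restriction (`card_interlace_comm`), so the Gram matrix of the Young modules is also `Kᵗ K`,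
where `K` is the matrix of Kostka numbers (`ip_permChar_permChar`). The matrix `K` is unitriangular
with respect to the weight. Downward elimination together with `σ_E ⊆ Y_E` and positivity of the
inner product shows that `K` is the multiplicity matrix of the `σ_F` in the Young modules
(`eq_sum_of_triangular`, `permChar_eq_sum`).

*Pieri's rule.* Inducing `Y_E ⊗ 1` gives the Young module with one more row of length `m`, whose
Kostka numbers are by definition obtained by adding a horizontal strip of size `m`. Inverting `K`
gives Pieri's rule for characters (`pieriMap_chr_sigma`); complete reducibility and Schur's lemma
turn it into an isomorphism (`nonempty_equiv_directSum`).
-/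

namespace PieriSn

/-! ### Characters of induced representations -/

section Characters

open Representation

/-- The trace of the map induced on coinvariants is an average of traces: composing with the
averaging projector factors the quotient map through a section. -/
theorem trace_coinvariants_map {k G V : Type*} [Field k] [Group G] [Fintype G]
    [Invertible (Nat.card G : k)] [AddCommGroup V] [Module k V] [FiniteDimensional k V]
    (ρ : Representation k G V) (f : IntertwiningMap ρ ρ) :
    LinearMap.trace k (Coinvariants ρ) (Coinvariants.map ρ ρ f) =
      (Nat.card G : k)⁻¹ * ∑ g : G, LinearMap.trace k V (f.toLinearMap ∘ₗ ρ g) := by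
  have hne : (Nat.card G : k) ≠ 0 := Invertible.ne_zero _
  have comp_sum' : ∀ {W : Type _} [AddCommGroup W] [Module k W] (h : V →ₗ[k] W),
      h ∘ₗ ∑ g : G, ρ g = ∑ g : G, h ∘ₗ ρ g := fun h => by
    ext v; simp
  set avg : V →ₗ[k] V := (Nat.card G : k)⁻¹ • ∑ g : G, ρ g with havg
  have havg' : ∀ x : G, avg ∘ₗ ρ x = avg := by
    intro x
    ext v
    simp only [havg, LinearMap.comp_apply, LinearMap.smul_apply, LinearMap.sum_apply]
    congr 1
    refine Fintype.sum_bijective (· * x) (Group.mulRight_bijective x) _ _ fun g => ?_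
    rw [map_mul]; rfl
  let s : Coinvariants ρ →ₗ[k] V := Coinvariants.lift ρ avg havg'
  have hs : s ∘ₗ Coinvariants.mk ρ = avg := Coinvariants.lift_comp_mk ρ avg havg'
  have hmk : ∀ g, Coinvariants.mk ρ ∘ₗ ρ g = Coinvariants.mk ρ := fun g => by
    ext v; simp
  have hπ : Coinvariants.mk ρ ∘ₗ avg = Coinvariants.mk ρ := by
    rw [havg, LinearMap.comp_smul, comp_sum']
    simp only [hmk, Finset.sum_const, Finset.card_univ, ← Nat.card_eq_fintype_card]
    rw [← Nat.cast_smul_eq_nsmul k, smul_smul, inv_mul_cancel₀ hne, one_smul]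
  have hsec : Coinvariants.mk ρ ∘ₗ s = LinearMap.id := by
    apply Coinvariants.hom_ext
    rw [LinearMap.comp_assoc, hs, hπ]; rfl
  calc LinearMap.trace k _ (Coinvariants.map ρ ρ f)
      = LinearMap.trace k _ ((Coinvariants.map ρ ρ f ∘ₗ Coinvariants.mk ρ) ∘ₗ s) := by
        rw [LinearMap.comp_assoc, hsec, LinearMap.comp_id]
    _ = LinearMap.trace k V (s ∘ₗ (Coinvariants.map ρ ρ f ∘ₗ Coinvariants.mk ρ)) :=
        LinearMap.trace_comp_comm' _ _
    _ = LinearMap.trace k V (f.toLinearMap ∘ₗ avg) := by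
        have : s ∘ₗ Coinvariants.map ρ ρ f ∘ₗ Coinvariants.mk ρ = avg ∘ₗ f.toLinearMap := by
          rw [Coinvariants.map_comp_mk, ← LinearMap.comp_assoc, hs]; rfl
        rw [this, LinearMap.trace_comp_comm']
    _ = _ := by
        rw [havg, LinearMap.comp_smul, comp_sum', map_smul, map_sum, smul_eq_mul]

theorem trace_mapDomain {k H : Type*} [Field k] [Fintype H] [DecidableEq H] (f : H → H) :
    LinearMap.trace k (MonoidAlgebra k H) (MonoidAlgebra.mapDomainLinearMap k k f) =
      ∑ y : H, if f y = y then 1 else 0 := by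
  classical
  rw [LinearMap.trace_eq_matrix_trace k (MonoidAlgebra.basis H k), Matrix.trace]
  refine Finset.sum_congr rfl fun y _ => ?_
  rw [Matrix.diag_apply, LinearMap.toMatrix_apply]
  simp [MonoidAlgebra.basis, Finsupp.single_apply]

/-- The character of an induced representation. -/
theorem character_ind {k G H A : Type*} [Field k] [Group G] [Fintype G] [Group H] [Fintype H]
    [DecidableEq H] [Invertible (Nat.card G : k)] [AddCommGroup A] [Module k A]
    [FiniteDimensional k A] (φ : G →* H) (ρ : Representation k G A) (x : H) :
    (ind φ ρ).character x = (Nat.card G : k)⁻¹ *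
      ∑ g : G, ∑ y : H, if y * x * y⁻¹ = φ g then ρ.character g else 0 := by
  have : Module.Finite k (MonoidAlgebra k H) := .of_basis (MonoidAlgebra.basis H k)
  rw [character, ind_apply, trace_coinvariants_map]
  congr 1
  refine Finset.sum_congr rfl fun g _ => ?_
  have : ((MonoidAlgebra.mapDomainLinearMap k k fun y : H => y * x⁻¹).rTensor A) ∘ₗ
      (tprod ((leftRegular k H).comp φ) ρ) g =
      TensorProduct.map (MonoidAlgebra.mapDomainLinearMap k k fun y : H => φ g * y * x⁻¹) (ρ g) := by
    ext; simp
  erw [this]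
  rw [LinearMap.trace_tensorProduct', trace_mapDomain, Finset.sum_mul, character]
  refine Finset.sum_congr rfl fun y _ => ?_
  have : φ g * y * x⁻¹ = y ↔ y * x * y⁻¹ = φ g := by
    constructor <;> intro h
    · rw [mul_inv_eq_iff_eq_mul] at h ⊢; exact h.symm
    · rw [mul_inv_eq_iff_eq_mul] at h ⊢; exact h.symm
  simp only [this, ite_mul, one_mul, zero_mul]

instance {k G H A : Type*} [Field k] [Group G] [Group H] [Finite H] [AddCommGroup A] [Module k A]
    [FiniteDimensional k A] (φ : G →* H) (ρ : Representation k G A) :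
    FiniteDimensional k (IndV φ ρ) :=
  have : Module.Finite k (MonoidAlgebra k H) := .of_basis (MonoidAlgebra.basis H k)
  inferInstance

open scoped ComplexOrder in
/-- A complex representation of a finite group is unitary for some inner product; hence the
character of the inverse is the complex conjugate. -/
theorem character_inv {G V : Type*} [Group G] [Finite G] [AddCommGroup V] [Module ℂ V]
    [FiniteDimensional ℂ V] (ρ : Representation ℂ G V) (g : G) :
    ρ.character g⁻¹ = star (ρ.character g) := by
  classical
  have := Fintype.ofFinite G
  let b := Module.finBasis ℂ V
  let M : G → Matrix _ _ ℂ := fun g => LinearMap.toMatrix b b (ρ g)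
  have hM : ∀ g h, M (g * h) = M g * M h := fun g h => by
    simp only [M, map_mul]; exact LinearMap.toMatrix_mul b _ _
  have hM1 : M 1 = 1 := by simp only [M, map_one]; exact LinearMap.toMatrix_one b
  have htr : ∀ g, ρ.character g = (M g).trace := fun g =>
    LinearMap.trace_eq_matrix_trace ℂ b (ρ g)
  let P : Matrix _ _ ℂ := ∑ h : G, (M h).conjTranspose * M h
  have hP : P.PosDef := by
    have : P = (M 1).conjTranspose * M 1 + ∑ h ∈ Finset.univ.erase 1, (M h).conjTranspose * M h :=
      (Finset.add_sum_erase _ _ (Finset.mem_univ 1)).symm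
    rw [this, hM1]
    refine Matrix.PosDef.add_posSemidef (by simpa using Matrix.PosDef.one) ?_
    exact Matrix.posSemidef_sum _ fun h _ => Matrix.posSemidef_conjTranspose_mul_self _
  have hinv : (M g).conjTranspose * P * M g = P := by
    simp only [P, Finset.mul_sum, Finset.sum_mul]
    refine Fintype.sum_bijective (· * g) (Group.mulRight_bijective g) _ _ fun h => ?_
    rw [hM, Matrix.conjTranspose_mul]; simp only [Matrix.mul_assoc]
  have hdet : IsUnit P.det := (Matrix.isUnit_iff_isUnit_det P).1 hP.isUnit
  have h1 : P * M g⁻¹ = (M g).conjTranspose * P := by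
    calc P * M g⁻¹ = (M g).conjTranspose * P * (M g * M g⁻¹) := by
          rw [← Matrix.mul_assoc, hinv]
      _ = _ := by rw [← hM, mul_inv_cancel, hM1, mul_one]
  have h2 : M g⁻¹ = P⁻¹ * ((M g).conjTranspose * P) := by
    rw [← h1, ← Matrix.mul_assoc, Matrix.nonsing_inv_mul _ hdet, one_mul]
  rw [htr, htr, h2, Matrix.trace_mul_comm, Matrix.mul_assoc, Matrix.mul_nonsing_inv _ hdet,
    mul_one, Matrix.trace_conjTranspose]

end Characters

/-! ### Consequences of complete reducibility -/

section Semisimple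

open Representation

variable {G : Type} [Group G]

/-- The inclusion of a subrepresentation. -/
def subtypeMap {V : Type*} [AddCommGroup V] [Module ℂ V] {ρ : Representation ℂ G V}
    (N : Subrepresentation ρ) : IntertwiningMap N.toRepresentation ρ where
  toLinearMap := N.toSubmodule.subtype
  isIntertwining' _ := rfl

theorem exists_leftInverse [Finite G] {V W : Type*} [AddCommGroup V] [Module ℂ V] [AddCommGroup W]
    [Module ℂ W] {ρ : Representation ℂ G V} {σ : Representation ℂ G W}
    (f : IntertwiningMap ρ σ) (hf : Function.Injective f) :
    ∃ g : IntertwiningMap σ ρ, ∀ v, g (f v) = v := by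
  have : NeZero (Nat.card G : ℂ) := ⟨by exact_mod_cast Nat.card_pos.ne'⟩
  obtain ⟨g, hg⟩ := MonoidAlgebra.exists_leftInverse_of_injective
    (IntertwiningMap.equivLinearMapAsModule ρ σ f) (LinearMap.ker_eq_bot.2 hf)
  refine ⟨(IntertwiningMap.equivLinearMapAsModule σ ρ).symm g, fun v => ?_⟩
  exact LinearMap.congr_fun hg v

/-- If all intertwining maps `α → β` are multiples of `f ≠ 0`, then the image of `f` is
irreducible: projecting to a subrepresentation of it again gives a multiple of `f`. -/
theorem isIrreducible_range [Finite G] {V W : Type*} [AddCommGroup V] [Module ℂ V]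
    [AddCommGroup W] [Module ℂ W] {α : Representation ℂ G V} {β : Representation ℂ G W}
    (f : IntertwiningMap α β) (hf : f ≠ 0) (hall : ∀ g : IntertwiningMap α β, ∃ c : ℂ, g = c • f) :
    f.range.toRepresentation.IsIrreducible := by
  have hbt : ∀ N : Subrepresentation f.range.toRepresentation, N = ⊥ ∨ N = ⊤ := by
    intro N
    let i : IntertwiningMap N.toRepresentation β := (subtypeMap f.range).comp (subtypeMap N)
    have hi : Function.Injective i := fun x y h => Subtype.ext (Subtype.ext h)
    obtain ⟨p, hp⟩ := exists_leftInverse i hi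
    obtain ⟨c, hc⟩ := hall ((i.comp p).comp f)
    have hc' : ∀ a, i (p (f a)) = c • f a := fun a => by
      have := congrArg (fun g : IntertwiningMap α β => g a) hc
      simpa using this
    by_cases h0 : c = 0
    · left
      apply Subrepresentation.toSubmodule_injective
      change N.toSubmodule = ⊥
      rw [Submodule.eq_bot_iff]
      rintro ⟨x, hx⟩ hxN
      obtain ⟨a, rfl⟩ := (IntertwiningMap.mem_range _ _ f x).1 hx
      have h1 := hp ⟨⟨f a, hx⟩, hxN⟩
      have h2 : i ⟨⟨f a, hx⟩, hxN⟩ = f a := rfl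
      have h3 := hc' a
      rw [← h2, h1, h2, h0, zero_smul] at h3
      exact Subtype.ext h3
    · right
      apply Subrepresentation.toSubmodule_injective
      change N.toSubmodule = ⊤
      rw [Submodule.eq_top_iff']
      rintro ⟨x, hx⟩
      obtain ⟨a, rfl⟩ := (IntertwiningMap.mem_range _ _ f x).1 hx
      have h3 : (⟨f a, hx⟩ : f.range.toSubmodule) = c⁻¹ • (p (f a)).1 := by
        apply Subtype.ext
        change f a = c⁻¹ • i (p (f a))
        rw [hc', smul_smul, inv_mul_cancel₀ h0, one_smul]
      rw [h3]
      exact N.toSubmodule.smul_mem _ (p (f a)).2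
  obtain ⟨a, ha⟩ : ∃ a, f a ≠ 0 := by
    by_contra! h
    exact hf (DFunLike.ext _ _ h)
  have : Nontrivial (Subrepresentation f.range.toRepresentation) := by
    refine ⟨⊥, ⊤, fun h => ha ?_⟩
    have h1 : (⟨f a, (IntertwiningMap.mem_range _ _ f _).2 ⟨a, rfl⟩⟩ : f.range.toSubmodule) ∈
        (⊥ : Subrepresentation f.range.toRepresentation) := by
      rw [h]; exact Submodule.mem_top
    exact congrArg Subtype.val ((Submodule.mem_bot ℂ).1 h1)
  exact { eq_bot_or_eq_top := hbt }

variable {ι : Type} {V : ι → Type} [∀ i, AddCommGroup (V i)] [∀ i, Module ℂ (V i)]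
  {s : ∀ i, Representation ℂ G (V i)}

/-- The projection of a direct sum of representations to a summand. -/
noncomputable def componentMap (s : ∀ i, Representation ℂ G (V i)) (i : ι) :
    IntertwiningMap (directSum s) (s i) where
  toLinearMap := DirectSum.component ℂ ι V i
  isIntertwining' _ := LinearMap.ext fun _ => rfl

/-- A sum of pairwise non-isomorphic irreducible representations is multiplicity-free. -/
theorem isMultiplicityFree_directSum [∀ i, FiniteDimensional ℂ (V i)]
    (hirr : ∀ i, (s i).IsIrreducible)
    (hne : ∀ i j, Nonempty ((s i).Equiv (s j)) → i = j) : IsMultiplicityFree (directSum s) := by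
  intro W _ _ τ hτ
  by_cases hall : ∀ f : IntertwiningMap τ (directSum s), f = 0
  · refine rank_le_one_iff.2 ⟨0, fun f => ⟨0, by rw [hall f, smul_zero]⟩⟩
  push Not at hall
  obtain ⟨f, hf⟩ := hall
  have hcomp : ∀ g : IntertwiningMap τ (directSum s), g ≠ 0 →
      ∃ i, (componentMap s i).comp g ≠ 0 := by
    intro g hg
    by_contra! h
    refine hg (DFunLike.ext _ _ fun w => DFinsupp.ext fun i => ?_)
    exact congrArg (fun k : IntertwiningMap τ (s i) => k w) (h i)
  obtain ⟨i, hi⟩ := hcomp f hf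
  have hb := (IsIrreducible.bijective_or_eq_zero ((componentMap s i).comp f)).resolve_right hi
  let e : τ.Equiv (s i) := ((componentMap s i).comp f).ofBijective hb
  have hzero : ∀ g : IntertwiningMap τ (directSum s), ∀ j ≠ i, (componentMap s j).comp g = 0 := by
    intro g j hj
    refine (IsIrreducible.bijective_or_eq_zero ((componentMap s j).comp g)).resolve_left fun h => ?_
    exact hj (hne i j ⟨e.symm.trans (((componentMap s j).comp g).ofBijective h)⟩).symm
  refine rank_le_one_iff.2 ⟨f, fun g => ?_⟩
  obtain ⟨c, hc⟩ := (IsIrreducible.algebraMap_intertwiningMap_bijective_of_isAlgClosed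
    (ρ := s i)).2 (((componentMap s i).comp g).comp e.symm.toIntertwiningMap)
  refine ⟨c, DFunLike.ext _ _ fun w => DFinsupp.ext fun j => ?_⟩
  by_cases hj : j = i
  · subst hj
    have h1 := congrArg (fun k : IntertwiningMap (s j) (s j) => k (e w)) hc
    simp only [IntertwiningMap.algebraMap_apply] at h1
    have h2 : e.symm (e w) = w := e.symm_apply_apply w
    change c • e w = (componentMap s j) (g (e.symm (e w))) at h1
    rw [h2] at h1
    exact h1
  · have h1 := congrArg (fun k : IntertwiningMap τ (s j) => k w) (hzero (c • f) j hj)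
    have h2 := congrArg (fun k : IntertwiningMap τ (s j) => k w) (hzero g j hj)
    exact h1.trans h2.symm

theorem IsMultiplicityFree.congr {V W : Type} [AddCommGroup V] [Module ℂ V] [AddCommGroup W]
    [Module ℂ W] {ρ : Representation ℂ G V} {σ : Representation ℂ G W} (e : ρ.Equiv σ)
    (h : IsMultiplicityFree σ) : IsMultiplicityFree ρ := by
  intro U _ _ τ hτ
  obtain ⟨f, hf⟩ := rank_le_one_iff.1 (h U τ hτ)
  refine rank_le_one_iff.2 ⟨e.symm.toIntertwiningMap.comp f, fun g => ?_⟩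
  obtain ⟨c, hc⟩ := hf (e.toIntertwiningMap.comp g)
  refine ⟨c, DFunLike.ext _ _ fun w => ?_⟩
  have h1 : c • f w = e (g w) := congrArg (fun k : IntertwiningMap τ σ => k w) hc
  change c • e.symm (f w) = g w
  rw [← map_smul, h1]
  exact e.symm_apply_apply _

/-- A representation that contains pairwise non-isomorphic irreducible representations whose
dimensions add up to its own is their direct sum. -/
theorem nonempty_equiv_directSum [Finite G] [Fintype ι] [∀ i, FiniteDimensional ℂ (V i)]
    (hirr : ∀ i, (s i).IsIrreducible) (hne : ∀ i j, Nonempty ((s i).Equiv (s j)) → i = j)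
    {U : Type} [AddCommGroup U] [Module ℂ U] [FiniteDimensional ℂ U] (ρ : Representation ℂ G U)
    (hf : ∀ i, ∃ f : IntertwiningMap (s i) ρ, f ≠ 0)
    (hdim : Module.finrank ℂ U = ∑ i, Module.finrank ℂ (V i)) :
    Nonempty (ρ.Equiv (directSum s)) := by
  classical
  choose f hf using hf
  have hinj : ∀ i, Function.Injective (f i) := fun i =>
    (IsIrreducible.injective_or_eq_zero (f i)).resolve_right (hf i)
  choose p hp using fun i => exists_leftInverse (f i) (hinj i)
  have hpf : ∀ i j, i ≠ j → ∀ v, p j (f i v) = 0 := by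
    intro i j hij v
    have := (IsIrreducible.bijective_or_eq_zero ((p j).comp (f i))).resolve_left fun h =>
      hij (hne i j ⟨((p j).comp (f i)).ofBijective h⟩)
    exact congrArg (fun k : IntertwiningMap (s i) (s j) => k v) this
  let P : IntertwiningMap ρ (directSum s) :=
    { toLinearMap := ∑ i, (DirectSum.lof ℂ ι V i) ∘ₗ (p i).toLinearMap
      isIntertwining' := fun g => by
        ext u : 1
        simp only [LinearMap.comp_apply, LinearMap.sum_apply, map_sum]
        refine Finset.sum_congr rfl fun i _ => ?_
        rw [IntertwiningMap.toLinearMap_apply, (p i).isIntertwining]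
        simp [directSum, IntertwiningMap.toLinearMap_apply] }
  have hPf : ∀ i v, P (f i v) = DirectSum.lof ℂ ι V i v := by
    intro i v
    change (∑ j, (DirectSum.lof ℂ ι V j) ∘ₗ (p j).toLinearMap) (f i v) = _
    rw [LinearMap.sum_apply, Finset.sum_eq_single i]
    · simp [hp]
    · intro j _ hj
      simp [hpf i j hj.symm]
    · simp
  have hsurj : Function.Surjective P := by
    intro x
    induction x using DirectSum.induction_on with
    | zero => exact ⟨0, map_zero P⟩
    | of i v => exact ⟨f i v, hPf i v⟩
    | add x y hx hy =>
      obtain ⟨a, rfl⟩ := hx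
      obtain ⟨b, rfl⟩ := hy
      exact ⟨a + b, map_add P a b⟩
  have hfin : Module.finrank ℂ U = Module.finrank ℂ (DirectSum ι V) := by
    rw [hdim, Module.finrank_directSum]
  refine ⟨P.ofBijective ⟨?_, hsurj⟩⟩
  exact (LinearMap.injective_iff_surjective_of_finrank_eq_finrank hfin (f := P.toLinearMap)).2 hsurj

end Semisimple

/-! ### Colourings and permutation characters -/

section Colourings

open Equiv Finset

variable {α : Type} [Fintype α] [DecidableEq α]

/-- The content of a colouring: the number of points of each colour. -/
noncomputable def content (f : α → ℕ) : ℕ →₀ ℕ := ∑ x, Finsupp.single (f x) 1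

omit [DecidableEq α] in
theorem content_apply (f : α → ℕ) (i : ℕ) : content f i = #{x | f x = i} := by
  simp [content, Finsupp.finsetSum_apply, Finsupp.single_apply]

omit [DecidableEq α] in
theorem degree_content (f : α → ℕ) : (content f).degree = Fintype.card α := by
  simp [content]

omit [DecidableEq α] in
theorem content_comp {β : Type} [Fintype β] (f : α → ℕ) (σ : β ≃ α) :
    content (f ∘ σ) = content f :=
  Equiv.sum_comp σ fun x => Finsupp.single (f x) 1

/-- The finite set of colourings with a given content. -/
noncomputable def colourings (α : Type) [Fintype α] [DecidableEq α] (c : ℕ →₀ ℕ) :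
    Finset (α → ℕ) :=
  {f ∈ Fintype.piFinset fun _ : α => c.support | content f = c}

@[simp]
theorem mem_colourings {c : ℕ →₀ ℕ} {f : α → ℕ} : f ∈ colourings α c ↔ content f = c := by
  rw [colourings, mem_filter, and_iff_right_iff_imp, Fintype.mem_piFinset]
  rintro rfl x
  rw [Finsupp.mem_support_iff, content_apply, Finset.card_ne_zero]
  exact ⟨x, by simp⟩

/-- The permutation character of the action of the symmetric group on the colourings with content
`c`: the number of colourings fixed by a permutation. -/
noncomputable def permChar (α : Type) [Fintype α] [DecidableEq α] (c : ℕ →₀ ℕ) (g : Perm α) : ℝ :=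
  (#{f ∈ colourings α c | f ∘ g = f} : ℝ)

omit [DecidableEq α] in
/-- Permutations of the letters act transitively on the colourings of a given content. -/
theorem exists_perm_of_content_eq {f f' : α → ℕ} (h : content f = content f') :
    ∃ σ : Perm α, f ∘ σ = f' := by
  have h1 : ∀ i, Nonempty ({x // f' x = i} ≃ {x // f x = i}) := fun i => by
    rw [← Fintype.card_eq, Fintype.card_subtype, Fintype.card_subtype, ← content_apply,
      ← content_apply, h]
  exact ⟨Equiv.ofFiberEquiv fun i => (h1 i).some, funext fun x => Equiv.ofFiberEquiv_map _ x⟩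

omit [DecidableEq α] in
theorem exists_content_eq (c : ℕ →₀ ℕ) (hc : c.degree = Fintype.card α) :
    ∃ f : α → ℕ, content f = c := by
  have h1 : Fintype.card α = Fintype.card (Σ i : c.support, Fin (c i)) := by
    rw [Fintype.card_sigma, ← hc]
    simp only [Fintype.card_fin]
    exact (Finset.sum_coe_sort c.support (fun i => c i)).symm
  obtain ⟨e⟩ := Fintype.card_eq.1 h1
  refine ⟨fun x => (e x).1, ?_⟩
  rw [content, Equiv.sum_comp e (fun y => Finsupp.single (y.1 : ℕ) 1), Fintype.sum_sigma]
  simp only [sum_const, card_univ, Fintype.card_fin, Finsupp.smul_single, smul_eq_mul, mul_one]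
  rw [Finset.sum_coe_sort c.support (fun i => Finsupp.single i (c i))]
  exact Finsupp.sum_single c

/-- The permutations carrying one colouring to another form a coset of the stabiliser. -/
theorem card_perm_eq_of_content_eq {f f' : α → ℕ} (h : content f = content f') :
    #{σ : Perm α | f ∘ σ = f'} = #{σ : Perm α | f ∘ σ = f} := by
  obtain ⟨τ, rfl⟩ := exists_perm_of_content_eq h
  refine card_bij' (fun σ _ => σ * τ⁻¹) (fun σ _ => σ * τ) ?_ ?_ (by simp) (by simp)
  · intro σ hσ
    simp only [mem_filter, mem_univ, true_and] at hσ ⊢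
    rw [Perm.coe_mul, ← Function.comp_assoc, hσ, Function.comp_assoc, ← Perm.coe_mul]
    simp
  · intro σ hσ
    simp only [mem_filter, mem_univ, true_and] at hσ ⊢
    rw [Perm.coe_mul, ← Function.comp_assoc, hσ]

theorem permChar_conj (c : ℕ →₀ ℕ) (g y : Perm α) :
    permChar α c (y * g * y⁻¹) = permChar α c g := by
  rw [permChar, permChar, Nat.cast_inj]
  refine card_bij' (fun f _ => f ∘ y) (fun f _ => f ∘ ⇑y⁻¹) ?_ ?_ ?_ ?_
  · intro f hf
    simp only [mem_filter, mem_colourings, content_comp] at hf ⊢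
    refine ⟨hf.1, ?_⟩
    conv_rhs => rw [← hf.2]
    ext x; simp
  · intro f hf
    simp only [mem_filter, mem_colourings, content_comp] at hf ⊢
    refine ⟨hf.1, ?_⟩
    conv_rhs => rw [← hf.2]
    ext x; simp
  · intro f _; ext x; simp
  · intro f _; ext x; simp

theorem permChar_eq_zero {c : ℕ →₀ ℕ} (hc : c.degree ≠ Fintype.card α) (g : Perm α) :
    permChar α c g = 0 := by
  rw [permChar, Nat.cast_eq_zero, card_eq_zero, filter_eq_empty_iff]
  rintro f hf -
  exact hc (by rw [← mem_colourings.1 hf, degree_content])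

/-- The permutation character as a count over the stabiliser of one colouring. -/
theorem sum_conj_mem_stabilizer (f₀ : α → ℕ) (g : Perm α) :
    (#{y : Perm α | f₀ ∘ (y * g * y⁻¹ : Perm α) = f₀} : ℝ) =
      #{σ : Perm α | f₀ ∘ σ = f₀} * permChar α (content f₀) g := by
  rw [permChar, ← Nat.cast_mul, Nat.cast_inj]
  rw [card_eq_sum_card_fiberwise (f := fun y : Perm α => f₀ ∘ y)
    (t := {f ∈ colourings α (content f₀) | f ∘ g = f}), mul_comm, ← smul_eq_mul, ← sum_const]
  · refine sum_congr rfl fun f hf => ?_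
    simp only [mem_filter, mem_colourings] at hf
    rw [← card_perm_eq_of_content_eq hf.1.symm]
    congr 1
    ext y
    simp only [mem_filter, mem_univ, true_and, and_iff_right_iff_imp]
    rintro rfl
    conv_rhs => rw [← Function.comp_id f₀]
    have : f₀ ∘ ⇑(y * g * y⁻¹) = ((f₀ ∘ y) ∘ g) ∘ ⇑y⁻¹ := by ext x; simp
    rw [this, hf.2]; ext x; simp
  · intro y hy
    simp only [coe_filter, mem_univ, true_and, Set.mem_ofPred_eq, mem_colourings,
      content_comp] at hy ⊢
    conv_rhs => rw [← hy]
    ext x; simp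

/-- Burnside's lemma: the colourings of a given content form a single orbit. -/
theorem sum_permChar (c : ℕ →₀ ℕ) (hc : c.degree = Fintype.card α) :
    ∑ g : Perm α, permChar α c g = Fintype.card (Perm α) := by
  obtain ⟨f₀, rfl⟩ := exists_content_eq c hc
  have h0 : (#{σ : Perm α | f₀ ∘ σ = f₀} : ℝ) ≠ 0 := by
    rw [Nat.cast_ne_zero, card_ne_zero]
    exact ⟨1, by simp⟩
  have key : (#{σ : Perm α | f₀ ∘ σ = f₀} : ℝ) * ∑ g : Perm α, permChar α (content f₀) g =
      #{σ : Perm α | f₀ ∘ σ = f₀} * Fintype.card (Perm α) := by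
    simp_rw [mul_sum, ← sum_conj_mem_stabilizer, card_filter, Nat.cast_sum]
    rw [sum_comm, mul_comm, ← nsmul_eq_mul, ← Finset.card_univ, ← sum_const]
    refine sum_congr rfl fun y _ => ?_
    exact Equiv.sum_comp (MulAut.conj y).toEquiv
      (fun g : Perm α => (((if f₀ ∘ g = f₀ then 1 else 0 : ℕ)) : ℝ))
  exact mul_left_cancel₀ h0 key

open scoped Classical in
/-- Up to the factor `n!`, the multiplicity of the sign in a colouring representation: if a
colour is repeated, the transposition of two letters of that colour makes the signs cancel. -/
theorem sum_sign_mul_permChar (c : ℕ →₀ ℕ) (hc : c.degree = Fintype.card α) :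
    ∑ g : Perm α, ((Perm.sign g : ℤ) : ℝ) * permChar α c g =
      if ∀ i, c i ≤ 1 then (Fintype.card (Perm α) : ℝ) else 0 := by
  split_ifs with h
  · rw [← sum_permChar c hc]
    refine sum_congr rfl fun g _ => ?_
    by_cases hg : g = 1
    · simp [hg]
    · have : permChar α c g = 0 := by
        rw [permChar, Nat.cast_eq_zero, card_eq_zero, filter_eq_empty_iff]
        intro f hf hfg
        refine hg (Equiv.ext fun x => ?_)
        have h1 := h (f x)
        rw [← mem_colourings.1 hf, content_apply, card_le_one] at h1
        exact h1 _ (by simpa using congrFun hfg x) _ (by simp)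
      rw [this, mul_zero]
  · push Not at h
    obtain ⟨i, hi⟩ := h
    -- A transposition of two points of the same colour pairs off the terms.
    have : ∀ f ∈ colourings α c,
        ∑ g : Perm α, (if f ∘ g = f then ((Perm.sign g : ℤ) : ℝ) else 0) = 0 := by
      intro f hf
      rw [← mem_colourings.1 hf, content_apply, one_lt_card] at hi
      obtain ⟨a, ha, b, hb, hab⟩ := hi
      simp only [mem_filter, mem_univ, true_and] at ha hb
      have hswap : f ∘ Equiv.swap a b = f := by
        ext x
        simp only [Function.comp_apply, Equiv.swap_apply_def]
        split_ifs with h1 h2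
        · rw [h1, ha, hb]
        · rw [h2, ha, hb]
        · rfl
      have h1 := Equiv.sum_comp (Equiv.mulLeft (Equiv.swap a b))
        (fun g : Perm α => if f ∘ g = f then ((Perm.sign g : ℤ) : ℝ) else 0)
      have h2 : ∀ g : Perm α, (if f ∘ (Equiv.mulLeft (Equiv.swap a b) g : Perm α) = f
          then ((Perm.sign (Equiv.mulLeft (Equiv.swap a b) g) : ℤ) : ℝ) else 0) =
          -(if f ∘ g = f then ((Perm.sign g : ℤ) : ℝ) else 0) := by
        intro g
        rw [Equiv.coe_mulLeft, Perm.coe_mul, ← Function.comp_assoc, hswap, Perm.sign_mul,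
          Perm.sign_swap hab]
        split_ifs <;> simp
      simp_rw [h2, sum_neg_distrib] at h1
      linarith
    simp_rw [permChar, card_filter, Nat.cast_sum, mul_sum]
    rw [sum_comm]
    refine sum_eq_zero fun f hf => ?_
    rw [← this f hf]
    refine sum_congr rfl fun g _ => ?_
    split_ifs <;> simp

/-! ### Induction and restriction of permutation characters -/

omit [DecidableEq α] in
theorem content_sumElim {β : Type} [Fintype β] (f : α → ℕ) (f' : β → ℕ) :
    content (Sum.elim f f') = content f + content f' := by
  simp [content]

/-- A colouring of `k` letters, extended by one more colour on the last `m` letters. -/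
def extend {k : ℕ} (m r : ℕ) (f : Fin k → ℕ) : Fin (k + m) → ℕ :=
  Sum.elim f (fun _ : Fin m => r) ∘ finSumFinEquiv.symm

theorem content_extend {k : ℕ} (m r : ℕ) (f : Fin k → ℕ) :
    content (extend m r f) = content f + Finsupp.single r m := by
  rw [extend, content_comp, content_sumElim]
  simp [content]

theorem prodEmbedding_apply (k m : ℕ) (h : Perm (Fin k) × Perm (Fin m)) (x : Fin k ⊕ Fin m) :
    prodEmbedding k m h (finSumFinEquiv x) = finSumFinEquiv (Sum.map h.1 h.2 x) := by
  simp [prodEmbedding, Equiv.permCongrHom, Equiv.permCongr_apply, Perm.sumCongrHom]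

theorem prodEmbedding_injective (k m : ℕ) : Function.Injective (prodEmbedding k m) :=
  (finSumFinEquiv.permCongrHom.injective).comp Perm.sumCongrHom_injective

theorem sign_prodEmbedding (k m : ℕ) (h : Perm (Fin k) × Perm (Fin m)) :
    Perm.sign (prodEmbedding k m h) = Perm.sign h.1 * Perm.sign h.2 := by
  have : prodEmbedding k m h = finSumFinEquiv.permCongr (Perm.sumCongr h.1 h.2) := rfl
  rw [this, Perm.sign_permCongr, Perm.sign_sumCongr]

theorem extend_comp_prodEmbedding {k m r : ℕ} (f : Fin k → ℕ) (h : Perm (Fin k) × Perm (Fin m)) :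
    extend m r f ∘ prodEmbedding k m h = extend m r (f ∘ h.1) := by
  ext x
  obtain ⟨x, rfl⟩ := finSumFinEquiv.surjective x
  simp only [Function.comp_apply, prodEmbedding_apply, extend, Equiv.symm_apply_apply]
  cases x <;> rfl

theorem extend_injective {k : ℕ} (m r : ℕ) :
    Function.Injective (extend m r : (Fin k → ℕ) → Fin (k + m) → ℕ) := by
  intro f f' h
  ext x
  simpa [extend] using congrFun h (finSumFinEquiv (Sum.inl x))

/-- If the colour `r` is new, a permutation carrying one extended colouring to another one
preserves the set of the first `k` letters. -/
theorem exists_prodEmbedding_eq {k m r : ℕ} {f f' : Fin k → ℕ} 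
    (hf' : ∀ x, f' x ≠ r) {p : Perm (Fin (k + m))} (hp : extend m r f ∘ p = extend m r f') :
    ∃ h, prodEmbedding k m h = p := by
  have hmem : finSumFinEquiv.symm.permCongr p ∈ (Perm.sumCongrHom (Fin k) (Fin m)).range := by
    apply Perm.mem_sumCongrHom_range_of_perm_mapsTo_inl
    rintro _ ⟨x, rfl⟩
    have h1 := congrFun hp (finSumFinEquiv (Sum.inl x))
    simp only [extend, Function.comp_apply, Equiv.symm_apply_apply, Sum.elim_inl] at h1
    rw [Equiv.permCongr_apply, Equiv.symm_symm]
    rcases h2 : finSumFinEquiv.symm (p (finSumFinEquiv (Sum.inl x))) with z | z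
    · exact ⟨z, rfl⟩
    · rw [h2] at h1
      exact absurd h1.symm (hf' x)
  obtain ⟨h, hh⟩ := hmem
  refine ⟨h, ?_⟩
  change finSumFinEquiv.permCongr (Perm.sumCongrHom (Fin k) (Fin m) h) = p
  rw [hh]; ext x; simp

/-- Induction of class functions from `S_k` to `S_{k+m}`: the character of `Ind (V ⊗ 1)` in terms
of the character of `V`. -/
noncomputable def pieriMap (k m : ℕ) :
    (Perm (Fin k) → ℝ) →ₗ[ℝ] (Perm (Fin (k + m)) → ℝ) where
  toFun f g := (Fintype.card (Perm (Fin k) × Perm (Fin m)) : ℝ)⁻¹ *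
    ∑ h : Perm (Fin k) × Perm (Fin m), ∑ y : Perm (Fin (k + m)),
      if y * g * y⁻¹ = prodEmbedding k m h then f h.1 else 0
  map_add' f f' := by
    ext g
    simp only [Pi.add_apply, ← mul_add, ← sum_add_distrib]
    congr 1
    refine sum_congr rfl fun h _ => sum_congr rfl fun y _ => ?_
    split_ifs <;> simp
  map_smul' a f := by
    ext g
    simp only [Pi.smul_apply, smul_eq_mul, RingHom.id_apply, mul_sum]
    refine sum_congr rfl fun h _ => sum_congr rfl fun y _ => ?_
    split_ifs <;> ring

theorem pieriMap_apply (k m : ℕ) (f : Perm (Fin k) → ℝ) (g : Perm (Fin (k + m))) :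
    pieriMap k m f g = (Fintype.card (Perm (Fin k) × Perm (Fin m)) : ℝ)⁻¹ *
    ∑ h : Perm (Fin k) × Perm (Fin m), ∑ y : Perm (Fin (k + m)),
      if y * g * y⁻¹ = prodEmbedding k m h then f h.1 else 0 := rfl

/-- Extending a colouring of the first `k` letters by the new colour `r` on the last `m` and then
permuting reaches each colouring of the enlarged content `k! m!` times. -/
theorem card_extend_comp_eq {k m r : ℕ} {c : ℕ →₀ ℕ} (hr : c r = 0) (hc : c.degree = k)
    {F : Fin (k + m) → ℕ} (hF : content F = c + Finsupp.single r m) :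
    #{p ∈ (univ : Finset (Perm (Fin (k + m)))) ×ˢ colourings (Fin k) c |
      extend m r p.2 ∘ p.1 = F} = Fintype.card (Perm (Fin k) × Perm (Fin m)) := by
  obtain ⟨f₀, rfl⟩ := exists_content_eq (α := Fin k) c (by simpa using hc)
  obtain ⟨y₀, rfl⟩ := exists_perm_of_content_eq (f := extend m r f₀) (f' := F)
    (by rw [content_extend, hF])
  have hne : ∀ f : Fin k → ℕ, content f = content f₀ → ∀ x, f x ≠ r := by
    rintro f hf x rfl
    rw [← hf, content_apply, card_eq_zero] at hr
    exact (Finset.notMem_empty x) (hr ▸ by simp)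
  rw [← Finset.card_univ]
  symm
  refine card_bij (fun h _ => (prodEmbedding k m h * y₀, f₀ ∘ ⇑(h.1⁻¹))) ?_ ?_ ?_
  · intro h _
    simp only [mem_filter, mem_product, mem_univ, true_and, mem_colourings, content_comp]
    rw [Perm.coe_mul, ← Function.comp_assoc, extend_comp_prodEmbedding]
    congr 2
    ext x; simp
  · intro h _ h' _ hh
    exact prodEmbedding_injective k m (mul_right_cancel (Prod.ext_iff.1 hh).1)
  · rintro ⟨y, f⟩ hyf
    simp only [mem_filter, mem_product, mem_univ, true_and, mem_colourings] at hyf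
    have h1 : extend m r f ∘ (y * y₀⁻¹ : Perm _) = extend m r f₀ := by
      rw [Perm.coe_mul, ← Function.comp_assoc, hyf.2]
      ext x; simp
    obtain ⟨h, hh⟩ := exists_prodEmbedding_eq (hne f₀ rfl) h1
    refine ⟨h, mem_univ _, Prod.ext (by rw [hh]; simp) ?_⟩
    rw [← hh, extend_comp_prodEmbedding] at h1
    rw [← extend_injective m r h1]
    ext x; simp

/-- Inducing a permutation character on colourings adds a new colour: both sides count colourings
of `k + m` letters fixed by `g`. -/
theorem pieriMap_permChar {k m r : ℕ} {c : ℕ →₀ ℕ} (hr : c r = 0) (hc : c.degree = k) :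
    pieriMap k m (permChar (Fin k) c) = permChar (Fin (k + m)) (c + Finsupp.single r m) := by
  ext g
  have hcard : (Fintype.card (Perm (Fin k) × Perm (Fin m)) : ℝ) ≠ 0 := by
    exact_mod_cast Fintype.card_ne_zero
  rw [pieriMap_apply, inv_mul_eq_iff_eq_mul₀ hcard]
  have hne : ∀ f : Fin k → ℕ, content f = c → ∀ x, f x ≠ r := by
    rintro f rfl x rfl
    rw [content_apply, card_eq_zero] at hr
    exact (Finset.notMem_empty x) (hr ▸ by simp)
  have h1 : ∀ y : Perm (Fin (k + m)), ∑ h : Perm (Fin k) × Perm (Fin m),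
      (if y * g * y⁻¹ = prodEmbedding k m h then permChar (Fin k) c h.1 else 0) =
      ∑ f ∈ colourings (Fin k) c,
        if extend m r f ∘ (y * g * y⁻¹ : Perm _) = extend m r f then (1 : ℝ) else 0 := by
    intro y
    by_cases hy : ∃ h, prodEmbedding k m h = y * g * y⁻¹
    · obtain ⟨h, hh⟩ := hy
      rw [sum_eq_single h, if_pos hh.symm, permChar, card_filter, Nat.cast_sum]
      · refine sum_congr rfl fun f _ => ?_
        have : extend m r f ∘ (y * g * y⁻¹ : Perm _) = extend m r f ↔ f ∘ h.1 = f := by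
          rw [← hh, extend_comp_prodEmbedding, (extend_injective m r).eq_iff]
        simp only [this, Nat.cast_ite, Nat.cast_one, Nat.cast_zero]
      · intro h' _ hne'
        rw [if_neg]
        rw [← hh]
        exact fun h2 => hne' (prodEmbedding_injective k m h2).symm
      · simp
    · rw [sum_eq_zero, sum_eq_zero]
      · intro f hf
        rw [if_neg]
        intro h2
        have := hne f (mem_colourings.1 hf)
        exact hy (exists_prodEmbedding_eq this h2)
      · intro h _
        rw [if_neg]
        exact fun h2 => hy ⟨h, h2.symm⟩
  rw [sum_comm, sum_congr rfl fun y _ => h1 y, ← sum_product', ← Finset.sum_filter, sum_const,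
    nsmul_eq_mul, mul_one, permChar, ← Nat.cast_mul, Nat.cast_inj]
  rw [card_eq_sum_card_fiberwise
    (f := fun p : Perm (Fin (k + m)) × (Fin k → ℕ) => extend m r p.2 ∘ p.1)
    (t := {F ∈ colourings (Fin (k + m)) (c + Finsupp.single r m) | F ∘ g = F}), mul_comm,
    ← smul_eq_mul, ← sum_const]
  · refine sum_congr rfl fun F hF => ?_
    simp only [mem_filter, mem_colourings] at hF
    rw [← card_extend_comp_eq hr hc hF.1, filter_filter]
    congr 1
    ext ⟨y, f⟩
    simp only [mem_filter, mem_product, mem_univ, true_and, and_congr_right_iff,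
      and_iff_right_iff_imp]
    rintro - rfl
    have : extend m r f ∘ ⇑(y * g * y⁻¹) = ((extend m r f ∘ y) ∘ g) ∘ ⇑y⁻¹ := by ext x; simp
    rw [this, hF.2]; ext x; simp
  · rintro ⟨y, f⟩ hy
    simp only [coe_filter, mem_product, mem_univ, true_and, Set.mem_ofPred_eq, mem_colourings,
      content_comp] at hy ⊢
    refine ⟨by rw [content_extend, hy.1], ?_⟩
    conv_rhs => rw [← hy.2]
    ext x; simp

/-- Restriction of a permutation character to `S_k × S_m`: a colouring is a pair of colourings,
whose contents add up. -/
theorem permChar_prodEmbedding (k m : ℕ) (c : ℕ →₀ ℕ) (h : Perm (Fin k) × Perm (Fin m)) :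
    permChar (Fin (k + m)) c (prodEmbedding k m h) =
      ∑ p ∈ antidiagonal c, permChar (Fin k) p.1 h.1 * permChar (Fin m) p.2 h.2 := by
  simp only [permChar, ← Nat.cast_mul, ← card_product]
  rw [← Nat.cast_sum, ← card_sigma, Nat.cast_inj]
  refine card_bij' (fun F _ => ⟨(content (F ∘ finSumFinEquiv ∘ Sum.inl),
      content (F ∘ finSumFinEquiv ∘ Sum.inr)),
      (F ∘ finSumFinEquiv ∘ Sum.inl, F ∘ finSumFinEquiv ∘ Sum.inr)⟩)
    (fun q _ => Sum.elim q.2.1 q.2.2 ∘ finSumFinEquiv.symm) ?_ ?_ ?_ ?_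
  · intro F hF
    simp only [mem_filter, mem_colourings] at hF
    simp only [mem_sigma, mem_product, mem_filter, mem_colourings, true_and,
      HasAntidiagonal.mem_antidiagonal]
    refine ⟨?_, ?_, ?_⟩
    · rw [← content_sumElim, ← hF.1, ← content_comp F finSumFinEquiv]
      congr 1
      ext x; cases x <;> rfl
    · ext x
      conv_rhs => rw [← hF.2]
      simp only [Function.comp_apply, prodEmbedding_apply]; rfl
    · ext x
      conv_rhs => rw [← hF.2]
      simp only [Function.comp_apply, prodEmbedding_apply]; rfl
  · rintro ⟨⟨c₁, c₂⟩, f, f'⟩ hq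
    simp only [mem_sigma, mem_product, mem_filter, mem_colourings,
      HasAntidiagonal.mem_antidiagonal] at hq
    simp only [mem_filter, mem_colourings]
    refine ⟨by rw [content_comp, content_sumElim, hq.2.1.1, hq.2.2.1, hq.1], ?_⟩
    ext x
    obtain ⟨x, rfl⟩ := finSumFinEquiv.surjective x
    simp only [Function.comp_apply, prodEmbedding_apply, Equiv.symm_apply_apply]
    cases x with
    | inl x => exact congrFun hq.2.1.2 x
    | inr x => exact congrFun hq.2.2.2 x
  · intro F _
    ext x
    obtain ⟨x, rfl⟩ := finSumFinEquiv.surjective x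
    simp only [Function.comp_apply, Equiv.symm_apply_apply]
    cases x <;> rfl
  · rintro ⟨⟨c₁, c₂⟩, f, f'⟩ hq
    simp only [mem_sigma, mem_product, mem_filter, mem_colourings,
      HasAntidiagonal.mem_antidiagonal] at hq
    obtain ⟨-, ⟨rfl, -⟩, ⟨rfl, -⟩⟩ := hq
    have e1 : (Sum.elim f f' ∘ finSumFinEquiv.symm) ∘ finSumFinEquiv ∘ Sum.inl = f := by
      ext x; simp
    have e2 : (Sum.elim f f' ∘ finSumFinEquiv.symm) ∘ finSumFinEquiv ∘ Sum.inr = f' := by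
      ext x; simp
    simp only [e1, e2]

end Colourings

/-! ### The inner product of class functions -/

section InnerProduct

open Equiv Finset

variable {G : Type} [Group G] [Fintype G]

/-- The normalised inner product of real functions on a finite group. -/
noncomputable def ip (G : Type) [Group G] [Fintype G] : LinearMap.BilinForm ℝ (G → ℝ) :=
  LinearMap.mk₂ ℝ (fun f u => (Fintype.card G : ℝ)⁻¹ * ∑ g, f g * u g)
    (fun f f' u => by simp only [Pi.add_apply, add_mul, sum_add_distrib, mul_add])
    (fun a f u => by
      simp only [Pi.smul_apply, smul_eq_mul, mul_sum]
      exact sum_congr rfl fun _ _ => by ring)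
    (fun f u u' => by simp only [Pi.add_apply, mul_add, sum_add_distrib])
    (fun a f u => by
      simp only [Pi.smul_apply, smul_eq_mul, mul_sum]
      exact sum_congr rfl fun _ _ => by ring)

theorem ip_apply (f u : G → ℝ) : ip G f u = (Fintype.card G : ℝ)⁻¹ * ∑ g, f g * u g := rfl

theorem ip_comm (f u : G → ℝ) : ip G f u = ip G u f := by
  simp only [ip_apply, mul_comm]

theorem eq_zero_of_ip_self_nonpos {f : G → ℝ} (h : ip G f f ≤ 0) : f = 0 := by
  have hpos : (0 : ℝ) < (Fintype.card G : ℝ)⁻¹ := by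
    have : 0 < Fintype.card G := Fintype.card_pos
    positivity
  have h1 : ∑ g, f g * f g ≤ 0 := nonpos_of_mul_nonpos_right h hpos
  have h2 := (sum_eq_zero_iff_of_nonneg fun g _ => mul_self_nonneg (f g)).1
    (le_antisymm h1 (sum_nonneg fun g _ => mul_self_nonneg (f g)))
  exact funext fun g => mul_self_eq_zero.1 (h2 g (mem_univ g))

/-- The sign character, with real values. -/
noncomputable def sgnChar (α : Type) [Fintype α] [DecidableEq α] (g : Perm α) : ℝ :=
  ((Perm.sign g : ℤ) : ℝ)

/-- Frobenius reciprocity for `pieriMap`. -/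
theorem ip_pieriMap (k m : ℕ) (f : Perm (Fin k) → ℝ) (u : Perm (Fin (k + m)) → ℝ)
    (hu : ∀ g y, u (y * g * y⁻¹) = u g) :
    ip _ (pieriMap k m f) u = (Fintype.card (Perm (Fin k) × Perm (Fin m)) : ℝ)⁻¹ *
      ∑ h : Perm (Fin k) × Perm (Fin m), f h.1 * u (prodEmbedding k m h) := by
  have h1 : ∀ (h : Perm (Fin k) × Perm (Fin m)) (y : Perm (Fin (k + m))),
      ∑ g, (if y * g * y⁻¹ = prodEmbedding k m h then f h.1 else 0) * u g =
        f h.1 * u (prodEmbedding k m h) := by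
    intro h y
    have := Equiv.sum_comp (MulAut.conj y).toEquiv
      (fun g => (if g = prodEmbedding k m h then f h.1 else 0) * u g)
    refine ((sum_congr rfl fun g _ => ?_).trans this).trans (by simp)
    change _ = _ * u (y * g * y⁻¹)
    rw [hu]; rfl
  have hne : (Fintype.card (Perm (Fin (k + m))) : ℝ) ≠ 0 := by
    exact_mod_cast Fintype.card_ne_zero
  rw [ip_apply, inv_mul_eq_iff_eq_mul₀ hne, mul_left_comm]
  rw [sum_congr rfl fun g _ => by rw [pieriMap_apply, mul_assoc], ← mul_sum]
  congr 1
  simp_rw [sum_mul]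
  rw [sum_comm, mul_sum]
  refine sum_congr rfl fun h _ => ?_
  rw [sum_comm, sum_congr rfl fun y _ => h1 h y, sum_const, nsmul_eq_mul, Finset.card_univ]

theorem ip_pieriMap_permChar (k m : ℕ) (f : Perm (Fin k) → ℝ) (c : ℕ →₀ ℕ) :
    ip _ (pieriMap k m f) (permChar (Fin (k + m)) c) =
      ∑ p ∈ antidiagonal c, if p.2.degree = m then ip _ f (permChar (Fin k) p.1) else 0 := by
  rw [ip_pieriMap _ _ _ _ fun g y => permChar_conj c g y]
  simp_rw [permChar_prodEmbedding, mul_sum]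
  rw [sum_comm]
  refine sum_congr rfl fun p _ => ?_
  rw [← mul_sum]
  have hcard : (Fintype.card (Perm (Fin m)) : ℝ) ≠ 0 := by exact_mod_cast Fintype.card_ne_zero
  rw [Fintype.sum_prod_type]
  simp_rw [← mul_assoc, ← mul_sum]
  rw [← sum_mul, Fintype.card_prod, Nat.cast_mul, mul_inv, ip_apply]
  split_ifs with hp
  · rw [sum_permChar p.2 (by simpa using hp)]
    field_simp
  · simp_rw [permChar_eq_zero (α := Fin m) (c := p.2) (by simpa using hp)]
    simp

open scoped Classical in
/-- The twisted version of `ip_pieriMap_permChar`: the new letters must have distinct colours. -/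
theorem ip_sgn_pieriMap_permChar (k m : ℕ) (f : Perm (Fin k) → ℝ) (c : ℕ →₀ ℕ) :
    ip _ (sgnChar _ * pieriMap k m f) (permChar (Fin (k + m)) c) =
      ∑ p ∈ antidiagonal c, if p.2.degree = m ∧ ∀ i, p.2 i ≤ 1 then
        ip _ (sgnChar _ * f) (permChar (Fin k) p.1) else 0 := by
  have h0 : ip _ (sgnChar _ * pieriMap k m f) (permChar (Fin (k + m)) c) =
      ip _ (pieriMap k m f) (sgnChar _ * permChar (Fin (k + m)) c) := by
    simp only [ip_apply, Pi.mul_apply]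
    congr 1
    exact sum_congr rfl fun _ _ => by ring
  rw [h0, ip_pieriMap]
  swap
  · intro g y
    simp only [Pi.mul_apply, permChar_conj, sgnChar, Perm.sign_mul, Perm.sign_inv]
    congr 3
    rw [mul_comm, ← mul_assoc, Int.units_mul_self, one_mul]
  simp_rw [Pi.mul_apply, permChar_prodEmbedding, mul_sum]
  rw [sum_comm]
  refine sum_congr rfl fun p _ => ?_
  rw [← mul_sum]
  have hcard : (Fintype.card (Perm (Fin m)) : ℝ) ≠ 0 := by exact_mod_cast Fintype.card_ne_zero
  have h1 : ∀ h : Perm (Fin k) × Perm (Fin m),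
      f h.1 * (sgnChar _ (prodEmbedding k m h) * (permChar (Fin k) p.1 h.1 *
        permChar (Fin m) p.2 h.2)) = (sgnChar _ h.1 * f h.1 * permChar (Fin k) p.1 h.1) *
        (((Perm.sign h.2 : ℤ) : ℝ) * permChar (Fin m) p.2 h.2) := by
    intro h
    simp only [sgnChar, sign_prodEmbedding, Units.val_mul, Int.cast_mul]
    ring
  rw [sum_congr rfl fun h _ => h1 h, Fintype.sum_prod_type]
  simp_rw [← mul_sum]
  rw [← sum_mul, Fintype.card_prod, Nat.cast_mul, mul_inv, ip_apply]
  by_cases hp : p.2.degree = m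
  · rw [sum_sign_mul_permChar p.2 (by simpa using hp)]
    simp only [hp, true_and, Pi.mul_apply]
    split_ifs
    · field_simp
    · simp
  · simp_rw [permChar_eq_zero (α := Fin m) (c := p.2) (by simpa using hp)]
    simp [hp]

end InnerProduct

/-! ### Real characters of symmetric groups -/

section RealCharacters

open Equiv Finset Representation

/-- The character of a representation of a symmetric group, as a real function. -/
noncomputable def chr {n : ℕ} {V : Type} [AddCommGroup V] [Module ℂ V]
    (ρ : Representation ℂ (Perm (Fin n)) V) (g : Perm (Fin n)) : ℝ := (ρ.character g).re

/-- The characters of a symmetric group are real, since every permutation is conjugate to its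
inverse. -/
theorem ofReal_chr {n : ℕ} {V : Type} [AddCommGroup V] [Module ℂ V] [FiniteDimensional ℂ V]
    (ρ : Representation ℂ (Perm (Fin n)) V) (g : Perm (Fin n)) :
    ((chr ρ g : ℝ) : ℂ) = ρ.character g := by
  have h1 : IsConj g g⁻¹ := by
    rw [Perm.isConj_iff_cycleType_eq, Perm.cycleType_inv]
  obtain ⟨y, hy⟩ := isConj_iff.1 h1
  have h2 : star (ρ.character g) = ρ.character g := by
    rw [← character_inv, ← hy, char_conj]
  exact Complex.conj_eq_iff_re.1 h2

theorem chr_inv {n : ℕ} {V : Type} [AddCommGroup V] [Module ℂ V] [FiniteDimensional ℂ V]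
    (ρ : Representation ℂ (Perm (Fin n)) V) (g : Perm (Fin n)) : chr ρ g⁻¹ = chr ρ g := by
  rw [chr, character_inv, chr]; simp

theorem ip_chr {n : ℕ} {V W : Type} [AddCommGroup V] [Module ℂ V] [FiniteDimensional ℂ V]
    [AddCommGroup W] [Module ℂ W] [FiniteDimensional ℂ W]
    (ρ : Representation ℂ (Perm (Fin n)) V) (σ : Representation ℂ (Perm (Fin n)) W) :
    ip _ (chr ρ) (chr σ) = Module.finrank ℂ (IntertwiningMap ρ σ) := by
  have : (Nat.card (Perm (Fin n)) : ℂ) ≠ 0 := by exact_mod_cast Nat.card_pos.ne'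
  let : Invertible (Nat.card (Perm (Fin n)) : ℂ) := invertibleOfNonzero this
  have h := card_inv_mul_sum_char_mul_char_eq_finrank ρ σ
  rw [← Complex.ofReal_inj, ip_apply, Complex.ofReal_natCast, ← h, Nat.card_eq_fintype_card]
  push_cast
  congr 1
  refine sum_congr rfl fun g _ => ?_
  rw [ofReal_chr, ← ofReal_chr σ, ← ofReal_chr ρ, ← ofReal_chr ρ, chr_inv, mul_comm]

theorem chr_one {n : ℕ} {V : Type} [AddCommGroup V] [Module ℂ V] [FiniteDimensional ℂ V]
    (ρ : Representation ℂ (Perm (Fin n)) V) : chr ρ 1 = Module.finrank ℂ V := by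
  rw [chr, char_one]; simp

/-- The content of the Young diagram `D`: `rowLen i` letters of colour `i`. -/
noncomputable def rowContent (D : YoungDiagram) : ℕ →₀ ℕ :=
  Finsupp.onFinset (range (D.colLen 0)) D.rowLen fun i hi => by
    rw [mem_range, ← YoungDiagram.mem_iff_lt_colLen, YoungDiagram.mem_iff_lt_rowLen]
    exact Nat.pos_of_ne_zero hi

@[simp]
theorem rowContent_apply (D : YoungDiagram) (i : ℕ) : rowContent D i = D.rowLen i := rfl

theorem sum_rowLen (D : YoungDiagram) (N : ℕ) :
    ∑ i ∈ range N, D.rowLen i = #{x ∈ D.cells | x.1 < N} := by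
  rw [card_eq_sum_card_fiberwise (f := Prod.fst) (t := range N)]
  · refine sum_congr rfl fun i hi => ?_
    rw [D.rowLen_eq_card, YoungDiagram.row, filter_filter]
    congr 1
    ext x
    simp only [mem_filter, and_congr_right_iff]
    have := mem_range.1 hi
    omega
  · intro x hx
    simpa using (mem_filter.1 hx).2

theorem fst_lt_colLen_zero {D : YoungDiagram} {x : ℕ × ℕ} (hx : x ∈ D.cells) :
    x.1 < D.colLen 0 := by
  rw [← YoungDiagram.mem_iff_lt_colLen]
  exact D.up_left_mem le_rfl (Nat.zero_le _) (show (x.1, x.2) ∈ D from hx)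

theorem sum_rowLen_eq_card (D : YoungDiagram) {N : ℕ} (hN : D.colLen 0 ≤ N) :
    ∑ i ∈ range N, D.rowLen i = D.card := by
  rw [sum_rowLen, filter_true_of_mem fun x hx => (fst_lt_colLen_zero hx).trans_le hN]

theorem degree_rowContent (D : YoungDiagram) : (rowContent D).degree = D.card := by
  rw [← sum_rowLen_eq_card D le_rfl, Finsupp.degree_apply]
  exact sum_subset Finsupp.support_onFinset_subset fun i _ hi => Finsupp.notMem_support_iff.1 hi

end RealCharacters

/-! ### Characters of Young modules -/

section YoungModules

open Equiv Finset Representation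

theorem exists_lt_sum_rowLen {n : ℕ} (D : Diagram n) (i : Fin n) :
    ∃ r, (i : ℕ) < ∑ j ∈ range (r + 1), D.1.rowLen j := by
  refine ⟨D.1.colLen 0, ?_⟩
  rw [sum_rowLen_eq_card D.1 (Nat.le_succ _), D.2]
  exact i.2

/-- The colouring of `Fin n` by the rows of the standard tabloid. -/
noncomputable def tabloidColouring {n : ℕ} (D : Diagram n) (i : Fin n) : ℕ :=
  Nat.find (exists_lt_sum_rowLen D i)

theorem tabloidColouring_eq_iff {n : ℕ} (D : Diagram n) (i : Fin n) (r : ℕ) :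
    tabloidColouring D i = r ↔ i ∈ tabloidRow D r := by
  rw [tabloidColouring, Nat.find_eq_iff, tabloidRow, Set.mem_ofPred_eq, and_comm]
  refine and_congr_left fun _ => ⟨fun h => ?_, fun h q hq => ?_⟩
  · cases r with
    | zero => simp
    | succ q => exact not_lt.1 (h q q.lt_succ_self)
  · rw [not_lt]
    exact (sum_le_sum_of_subset (range_subset_range.2 hq)).trans h

theorem content_tabloidColouring {n : ℕ} (D : Diagram n) :
    content (tabloidColouring D) = rowContent D.1 := by
  ext r
  rw [content_apply, rowContent_apply]
  simp only [tabloidColouring_eq_iff, tabloidRow, Set.mem_ofPred_eq]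
  have hle : ∑ j ∈ range (r + 1), D.1.rowLen j ≤ n := by
    rw [sum_rowLen]
    exact (card_filter_le _ _).trans D.2.le
  calc _ = #(Ico (∑ j ∈ range r, D.1.rowLen j) (∑ j ∈ range (r + 1), D.1.rowLen j)) := by
        refine card_bij (fun x _ => (x : ℕ)) (fun x hx => ?_) (fun x _ y _ h => Fin.ext h)
          fun x hx => ?_
        · simpa using hx
        · rw [mem_Ico] at hx
          exact ⟨⟨x, hx.2.trans_le hle⟩, by simpa using hx, rfl⟩
    _ = D.1.rowLen r := by rw [Nat.card_Ico, sum_range_succ]; omega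

theorem mem_youngSubgroup_iff {n : ℕ} (D : Diagram n) (σ : Perm (Fin n)) :
    σ ∈ youngSubgroup D ↔ tabloidColouring D ∘ σ = tabloidColouring D := by
  simp only [youngSubgroup, Subgroup.mem_iInf, MulAction.mem_stabilizer_set, Perm.smul_def,
    ← tabloidColouring_eq_iff]
  constructor
  · intro h
    ext x
    exact (h _ x).2 rfl
  · intro h r x
    rw [← congrFun h x]; rfl

theorem chr_ind_youngSubgroup {n : ℕ} (D : Diagram n)
    (ρ : Representation ℂ (youngSubgroup D) ℂ) (u : Perm (Fin n) → ℂ)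
    (hu : ∀ g y, u (y * g * y⁻¹) = u g) (hρ : ∀ h, ρ.character h = u h) (g : Perm (Fin n)) :
    (ind (youngSubgroup D).subtype ρ).character g = u g * permChar (Fin n) (rowContent D.1) g := by
  classical
  have hne : (Nat.card (youngSubgroup D) : ℂ) ≠ 0 := by exact_mod_cast Nat.card_pos.ne'
  let : Invertible (Nat.card (youngSubgroup D) : ℂ) := invertibleOfNonzero hne
  have hcard : Nat.card (youngSubgroup D) =
      #{σ : Perm (Fin n) | tabloidColouring D ∘ σ = tabloidColouring D} := by
    simp_rw [← mem_youngSubgroup_iff]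
    rw [Nat.card_eq_fintype_card, Fintype.card_subtype]
  have h1 : ∀ y : Perm (Fin n), ∑ h : youngSubgroup D,
      (if y * g * y⁻¹ = (youngSubgroup D).subtype h then ρ.character h else 0) =
      if tabloidColouring D ∘ (y * g * y⁻¹ : Perm _) = tabloidColouring D then u g else 0 := by
    intro y
    simp_rw [← mem_youngSubgroup_iff]
    split_ifs with hy
    · rw [sum_eq_single ⟨_, hy⟩]
      · simp [hρ, hu]
      · intro h _ hh
        rw [if_neg]
        exact fun h2 => hh (Subtype.ext h2.symm)
      · simp
    · refine sum_eq_zero fun h _ => if_neg fun h2 => hy ?_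
      rw [h2]; exact h.2
  rw [character_ind, sum_comm, sum_congr rfl fun y _ => h1 y, ← sum_filter, sum_const,
    nsmul_eq_mul, inv_mul_eq_iff_eq_mul₀ hne, hcard, mul_left_comm, mul_comm]
  congr 1
  have h2 := sum_conj_mem_stabilizer (tabloidColouring D) g
  rw [content_tabloidColouring] at h2
  exact_mod_cast h2

theorem chr_youngModule {n : ℕ} (D : Diagram n) :
    chr (youngModule D) = permChar (Fin n) (rowContent D.1) := by
  ext g
  rw [chr, chr_ind_youngSubgroup D _ (fun _ => 1) (fun _ _ => rfl)]
  · simp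
  · intro h
    simp [character, Representation.trivial]

theorem chr_twistedYoungModule {n : ℕ} (D : Diagram n) :
    chr (twistedYoungModule D) = sgnChar (Fin n) * permChar (Fin n) (rowContent D.1) := by
  ext g
  rw [chr, chr_ind_youngSubgroup D _ (fun g => ((Perm.sign g : ℤ) : ℂ))]
  · simp [sgnChar]
  · intro g y
    simp only [Perm.sign_mul, Perm.sign_inv]
    rw [mul_comm, ← mul_assoc, Int.units_mul_self, one_mul]
  · intro h
    simp [character, sgn]

/-- The Frobenius formula for the character of the representation induced from `S_k × S_m`. -/
theorem chr_pieriInd {k : ℕ} (D : Diagram k) (m : ℕ) :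
    chr (pieriInd D m) = pieriMap k m (chr (sigma D)) := by
  ext g
  have hne : (Nat.card (Perm (Fin k) × Perm (Fin m)) : ℂ) ≠ 0 := by
    exact_mod_cast Nat.card_pos.ne'
  let : Invertible (Nat.card (Perm (Fin k) × Perm (Fin m)) : ℂ) := invertibleOfNonzero hne
  have h1 : ∀ h, (sigmaTensorTrivial D m).character h = chr (sigma D) h.1 := by
    intro h
    rw [char_tensor, Pi.mul_apply, ofReal_chr]
    have : character ((Representation.trivial ℂ (Equiv.Perm (Fin m)) ℂ).comp
      (MonoidHom.snd (Equiv.Perm (Fin k)) (Equiv.Perm (Fin m)))) h = 1 := by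
      simp [character]
    rw [this, mul_one]; rfl
  rw [← Complex.ofReal_inj, ofReal_chr, character_ind, pieriMap_apply, Nat.card_eq_fintype_card]
  simp_rw [h1]
  push_cast
  congr 1
  refine sum_congr rfl fun h _ => sum_congr rfl fun y _ => ?_
  split_ifs <;> simp

end YoungModules

/-! ### Horizontal strips -/

section Strips

open Finset

theorem ext_rowLen {D E : YoungDiagram} (h : ∀ i, D.rowLen i = E.rowLen i) : D = E := by
  apply YoungDiagram.ext
  ext ⟨i, j⟩
  rw [YoungDiagram.mem_cells, YoungDiagram.mem_cells, YoungDiagram.mem_iff_lt_rowLen,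
    YoungDiagram.mem_iff_lt_rowLen, h]

theorem le_iff_rowLen {D E : YoungDiagram} : D ≤ E ↔ ∀ i, D.rowLen i ≤ E.rowLen i := by
  rw [← YoungDiagram.cells_subset_iff]
  constructor
  · intro h i
    by_contra! hlt
    have h1 : (i, E.rowLen i) ∈ D := YoungDiagram.mem_iff_lt_rowLen.2 hlt
    exact lt_irrefl _ (YoungDiagram.mem_iff_lt_rowLen.1 (h h1))
  · rintro h ⟨i, j⟩ hx
    rw [YoungDiagram.mem_cells, YoungDiagram.mem_iff_lt_rowLen] at hx ⊢
    exact hx.trans_le (h i)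

theorem rowLen_eq_zero {D : YoungDiagram} {i : ℕ} (h : D.colLen 0 ≤ i) : D.rowLen i = 0 := by
  by_contra h0
  have h1 : (i, 0) ∈ D := YoungDiagram.mem_iff_lt_rowLen.2 (Nat.pos_of_ne_zero h0)
  rw [YoungDiagram.mem_iff_lt_colLen] at h1
  omega

theorem colLen_zero_le_card (D : YoungDiagram) : D.colLen 0 ≤ D.card := by
  rw [D.colLen_eq_card]
  exact card_filter_le _ _

theorem rowLen_eq_zero_of_card_le {D : YoungDiagram} {i : ℕ} (h : D.card ≤ i) : D.rowLen i = 0 :=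
  rowLen_eq_zero ((colLen_zero_le_card D).trans h)

theorem eq_bot_of_card {D : YoungDiagram} (h : D.card = 0) : D = ⊥ := by
  apply YoungDiagram.ext
  rw [YoungDiagram.cells_bot]
  exact card_eq_zero.1 h

/-- The Young diagram with prescribed row lengths. -/
def ofRows (f : ℕ → ℕ) (hf : Antitone f) (N : ℕ) (_hN : ∀ i, N ≤ i → f i = 0) : YoungDiagram where
  cells := {x ∈ range N ×ˢ range (f 0) | x.2 < f x.1}
  isLowerSet := by
    rintro ⟨i, j⟩ ⟨i', j'⟩ ⟨h1, h2⟩ hx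
    simp only [coe_filter, mem_product, mem_range, Set.mem_ofPred_eq] at hx h1 h2 ⊢
    have h3 := hf h1
    exact ⟨⟨by omega, by omega⟩, by omega⟩

theorem rowLen_ofRows (f : ℕ → ℕ) (hf : Antitone f) (N : ℕ) (hN : ∀ i, N ≤ i → f i = 0) (i : ℕ) :
    (ofRows f hf N hN).rowLen i = f i := by
  refine eq_of_forall_lt_iff fun j => ?_
  rw [← YoungDiagram.mem_iff_lt_rowLen, ← YoungDiagram.mem_cells]
  simp only [ofRows, mem_filter, mem_product, mem_range, and_iff_right_iff_imp]
  intro h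
  refine ⟨?_, h.trans_le (hf (Nat.zero_le i))⟩
  by_contra! hi
  rw [hN i hi] at h
  omega

/-- The row lengths of `C` and `F` interlace: equivalently, `C ⊆ F` and `F - C` is a horizontal
strip. -/
def Interlace (C F : YoungDiagram) : Prop :=
  ∀ i, F.rowLen (i + 1) ≤ C.rowLen i ∧ C.rowLen i ≤ F.rowLen i

theorem Interlace.le {C F : YoungDiagram} (h : Interlace C F) : C ≤ F :=
  le_iff_rowLen.2 fun i => (h i).2

theorem card_mono_diagram {C F : YoungDiagram} (h : C ≤ F) : C.card ≤ F.card :=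
  card_le_card (YoungDiagram.cells_subset_iff.2 h)

theorem isHorizontalStrip_iff {C F : YoungDiagram} {m : ℕ} :
    IsHorizontalStrip C F m ↔ C.card + m = F.card ∧ Interlace C F := by
  have hcol : (∀ j, F.colLen j ≤ C.colLen j + 1) ↔ ∀ i, F.rowLen (i + 1) ≤ C.rowLen i := by
    constructor
    · intro h i
      by_contra! hlt
      have h1 := YoungDiagram.mem_iff_lt_colLen.1 (YoungDiagram.mem_iff_lt_rowLen.2 hlt)
      have h2 : i < C.colLen (C.rowLen i) := by
        have := h (C.rowLen i)
        omega
      exact lt_irrefl _ (YoungDiagram.mem_iff_lt_rowLen.1 (YoungDiagram.mem_iff_lt_colLen.2 h2))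
    · intro h j
      by_contra! hlt
      have h1 := YoungDiagram.mem_iff_lt_rowLen.1 (YoungDiagram.mem_iff_lt_colLen.2 hlt)
      have h2 := h1.trans_le (h _)
      exact lt_irrefl _ (YoungDiagram.mem_iff_lt_colLen.1 (YoungDiagram.mem_iff_lt_rowLen.2 h2))
  rw [IsHorizontalStrip, hcol]
  constructor
  · rintro ⟨h1, h2, h3⟩
    have h4 := card_sdiff_add_card_eq_card (YoungDiagram.cells_subset_iff.2 h1)
    exact ⟨by rw [← h2, add_comm]; exact h4, fun i => ⟨h3 i, le_iff_rowLen.1 h1 i⟩⟩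
  · rintro ⟨h1, h2⟩
    have h4 := card_sdiff_add_card_eq_card (YoungDiagram.cells_subset_iff.2 h2.le)
    refine ⟨h2.le, ?_, fun i => (h2 i).1⟩
    have : #C.cells + m = #F.cells := h1
    omega

theorem finite_card_le (N : ℕ) : {D : YoungDiagram | D.card ≤ N}.Finite := by
  refine Set.Finite.of_injOn (f := YoungDiagram.cells)
    (t := ((range N ×ˢ range N).powerset : Finset (Finset (ℕ × ℕ))))
    ?_ (fun D _ E _ h => YoungDiagram.ext h) (finite_toSet _)
  intro D hD
  simp only [coe_powerset, Set.mem_preimage, Set.mem_powerset_iff, coe_subset]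
  rintro ⟨i, j⟩ hx
  have h1 : i < D.colLen 0 := fst_lt_colLen_zero hx
  have h2 : j < D.transpose.colLen 0 := fst_lt_colLen_zero (x := (j, i))
    (YoungDiagram.mem_transpose.2 hx)
  have h3 := colLen_zero_le_card D
  have h4 := colLen_zero_le_card D.transpose
  rw [card_transpose] at h4
  have : D.card ≤ N := hD
  rw [mem_product, mem_range, mem_range]
  omega

/-- The Young diagrams with at most `N` boxes. -/
noncomputable def diagramsLE (N : ℕ) : Finset YoungDiagram := (finite_card_le N).toFinset

/-- The Young diagrams with `n` boxes. -/
noncomputable def diagrams (n : ℕ) : Finset YoungDiagram := {D ∈ diagramsLE n | D.card = n}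

@[simp]
theorem mem_diagramsLE {N : ℕ} {D : YoungDiagram} : D ∈ diagramsLE N ↔ D.card ≤ N := by
  simp [diagramsLE]

@[simp]
theorem mem_diagrams {n : ℕ} {D : YoungDiagram} : D ∈ diagrams n ↔ D.card = n := by
  simp only [diagrams, mem_filter, mem_diagramsLE, and_iff_right_iff_imp]
  exact fun h => h.le

theorem sum_diagrams {n N : ℕ} (h : n ≤ N) (f : YoungDiagram → ℕ) :
    ∑ D ∈ diagrams n, f D = ∑ D ∈ diagramsLE N, if D.card = n then f D else 0 := by
  rw [← sum_filter]
  congr 1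
  ext D
  simp only [mem_diagrams, mem_filter, mem_diagramsLE]
  omega

theorem diagrams_zero : diagrams 0 = {⊥} := by
  ext D
  rw [mem_diagrams, mem_singleton]
  exact ⟨eq_bot_of_card, fun h => h ▸ rfl⟩

/-- The box count behind the bijection between horizontal strips: all rows but the first of `E` and
all rows of `C` together have as many boxes as `D` and `B`, less the longer of their first rows. -/
theorem card_add_card_add_max {D B C E : YoungDiagram}
    (h : ∀ i, E.rowLen (i + 1) + C.rowLen i =
      max (D.rowLen (i + 1)) (B.rowLen (i + 1)) + min (D.rowLen i) (B.rowLen i)) :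
    C.card + E.card + max (D.rowLen 0) (B.rowLen 0) = D.card + B.card + E.rowLen 0 := by
  obtain ⟨N, hN⟩ : ∃ N, ∀ X ∈ [D, B, C, E], X.colLen 0 ≤ N :=
    ⟨D.colLen 0 + B.colLen 0 + C.colLen 0 + E.colLen 0, by simp; omega⟩
  simp only [List.mem_cons, List.not_mem_nil, or_false, forall_eq_or_imp, forall_eq] at hN
  obtain ⟨hD, hB, hC, hE⟩ := hN
  have h1 := sum_congr (rfl : range N = range N) fun i _ => h i
  rw [sum_add_distrib, sum_add_distrib] at h1
  have h2 := sum_range_succ' E.rowLen N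
  have h3 := sum_range_succ' (fun i => max (D.rowLen i) (B.rowLen i)) N
  have h4 : ∑ i ∈ range (N + 1), max (D.rowLen i) (B.rowLen i) +
      ∑ i ∈ range (N + 1), min (D.rowLen i) (B.rowLen i) = D.card + B.card := by
    rw [← sum_rowLen_eq_card D (hD.trans N.le_succ), ← sum_rowLen_eq_card B (hB.trans N.le_succ),
      ← sum_add_distrib, ← sum_add_distrib]
    exact sum_congr rfl fun i _ => max_add_min _ _
  have h5 := sum_range_succ (fun i => min (D.rowLen i) (B.rowLen i)) N
  rw [rowLen_eq_zero hD, Nat.zero_min] at h5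
  rw [sum_rowLen_eq_card E (hE.trans N.le_succ)] at h2
  rw [sum_rowLen_eq_card C hC] at h1
  omega

open scoped Classical in
/-- The commutation rule for adding and removing horizontal strips. The two sides are matched by
the reflection `E_{i+1} + C_i = max(D_{i+1}, B_{i+1}) + min(D_i, B_i)` of row lengths, the size of
the first row of `E` being determined by the number of boxes. -/
theorem card_interlace_comm {D B : YoungDiagram} {m j : ℕ} (h : D.card + m = B.card + j) :
    #{E ∈ diagrams (D.card + m) | Interlace D E ∧ Interlace B E} =
      #{C ∈ diagramsLE D.card | (Interlace C D ∧ Interlace C B) ∧ B.card ≤ C.card + m} := by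
  have hanti : ∀ (X : YoungDiagram) (i : ℕ), X.rowLen (i + 1) ≤ X.rowLen i := fun X i =>
    X.rowLen_anti _ _ i.le_succ
  let f : YoungDiagram → ℕ → ℕ := fun E i =>
    max (D.rowLen (i + 1)) (B.rowLen (i + 1)) + min (D.rowLen i) (B.rowLen i) - E.rowLen (i + 1)
  let g : YoungDiagram → ℕ → ℕ := fun C i => match i with
    | 0 => max (D.rowLen 0) (B.rowLen 0) + (C.card + m - B.card)
    | i + 1 => max (D.rowLen (i + 1)) (B.rowLen (i + 1)) + min (D.rowLen i) (B.rowLen i) -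
        C.rowLen i
  have hf : ∀ E, Interlace D E → Interlace B E → Antitone (f E) := fun E h1 h2 =>
    antitone_nat_of_succ_le fun i => by
      have := h1 i; have := h2 i
      have := h1 (i + 1); have := h2 (i + 1); have := h1 (i + 1 + 1); have := h2 (i + 1 + 1)
      simp only [f]; omega
  have hfN : ∀ E i, D.card + B.card ≤ i → f E i = 0 := fun E i hi => by
    have h1 := rowLen_eq_zero_of_card_le (D := D) (i := i + 1) (by omega)
    have h2 := rowLen_eq_zero_of_card_le (D := B) (i := i + 1) (by omega)
    have h3 := rowLen_eq_zero_of_card_le (D := D) (i := i) (by omega)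
    simp only [f]; omega
  have hg : ∀ C, Interlace C D → Interlace C B → Antitone (g C) := fun C h1 h2 =>
    antitone_nat_of_succ_le fun i => by
      cases i with
      | zero => have := h1 0; have := h2 0; simp only [g]; omega
      | succ i =>
        have := h1 i; have := h2 i; have := h1 (i + 1); have := h2 (i + 1)
        simp only [g]; omega
  have hgN : ∀ C i, D.card + B.card + 1 ≤ i → g C i = 0 := fun C i hi => by
    obtain ⟨i, rfl⟩ : ∃ i', i = i' + 1 := ⟨i - 1, by omega⟩
    have h1 := rowLen_eq_zero_of_card_le (D := D) (i := i + 1) (by omega)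
    have h2 := rowLen_eq_zero_of_card_le (D := B) (i := i + 1) (by omega)
    have h3 := rowLen_eq_zero_of_card_le (D := D) (i := i) (by omega)
    simp only [g]; omega
  have key1 : ∀ E, ∀ (h1 : Interlace D E) (h2 : Interlace B E), E.card = D.card + m →
      (ofRows (f E) (hf E h1 h2) _ (hfN E)).card + m + max (D.rowLen 0) (B.rowLen 0) =
        B.card + E.rowLen 0 := by
    intro E h1 h2 hE
    have := card_add_card_add_max (D := D) (B := B) (E := E)
      (C := ofRows (f E) (hf E h1 h2) _ (hfN E)) fun i => by
        have := h1 i; have := h2 i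
        rw [rowLen_ofRows]; simp only [f]; omega
    omega
  have key2 : ∀ C, ∀ (h1 : Interlace C D) (h2 : Interlace C B), B.card ≤ C.card + m →
      (ofRows (g C) (hg C h1 h2) _ (hgN C)).card = D.card + m := by
    intro C h1 h2 hC
    have := card_add_card_add_max (D := D) (B := B) (C := C)
      (E := ofRows (g C) (hg C h1 h2) _ (hgN C)) fun i => by
        have := h1 i; have := h2 i
        rw [rowLen_ofRows]; simp only [g]; omega
    have e0 : g C 0 = max (D.rowLen 0) (B.rowLen 0) + (C.card + m - B.card) := rfl
    rw [rowLen_ofRows, e0] at this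
    omega
  refine card_bij'
    (fun E hE => ofRows (f E) (hf E (mem_filter.1 hE).2.1 (mem_filter.1 hE).2.2) _ (hfN E))
    (fun C hC => ofRows (g C) (hg C (mem_filter.1 hC).2.1.1 (mem_filter.1 hC).2.1.2) _ (hgN C))
    ?_ ?_ ?_ ?_
  · intro E hE
    obtain ⟨h0, h1, h2⟩ := mem_filter.1 hE
    rw [mem_diagrams] at h0
    have h3 := key1 E h1 h2 h0
    have h4 : Interlace (ofRows (f E) (hf E h1 h2) _ (hfN E)) D := fun i => by
      have := h1 i; have := h2 i; have := h1 (i + 1); have := h2 (i + 1)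
      rw [rowLen_ofRows]; simp only [f]; omega
    have h5 : Interlace (ofRows (f E) (hf E h1 h2) _ (hfN E)) B := fun i => by
      have := h1 i; have := h2 i; have := h1 (i + 1); have := h2 (i + 1)
      rw [rowLen_ofRows]; simp only [f]; omega
    refine mem_filter.2 ⟨mem_diagramsLE.2 (card_mono_diagram h4.le), ⟨h4, h5⟩, ?_⟩
    have := h1 0; have := h2 0
    omega
  · intro C hC
    obtain ⟨h0, ⟨h1, h2⟩, h3⟩ := mem_filter.1 hC
    refine mem_filter.2 ⟨mem_diagrams.2 (key2 C h1 h2 h3), fun i => ?_, fun i => ?_⟩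
    all_goals
      rw [rowLen_ofRows, rowLen_ofRows]
      have := h1 i; have := h2 i
      cases i with
      | zero => simp only [g]; omega
      | succ i => have := h1 i; have := h2 i; simp only [g]; omega
  · intro E hE
    obtain ⟨h0, h1, h2⟩ := mem_filter.1 hE
    refine ext_rowLen fun i => ?_
    rw [rowLen_ofRows]
    cases i with
    | zero =>
      have := key1 E h1 h2 (mem_diagrams.1 h0)
      have := h1 0; have := h2 0
      simp only [g]; omega
    | succ i =>
      have := h1 i; have := h2 i; have := h1 (i + 1); have := h2 (i + 1)
      simp only [g, rowLen_ofRows]; simp only [f]; omega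
  · intro C hC
    obtain ⟨h0, ⟨h1, h2⟩, h3⟩ := mem_filter.1 hC
    refine ext_rowLen fun i => ?_
    have := h1 i; have := h2 i
    rw [rowLen_ofRows]
    simp only [f, rowLen_ofRows]; simp only [g]; omega

end Strips

/-! ### Kostka numbers -/

section Kostka

open Finset
open scoped Classical

/-- The Kostka number: the number of chains of `r` successive horizontal strips of sizes
`c 0, c 1, …` from the empty diagram to `F`, that is, of semistandard tableaux of shape `F` with
`c i` entries `i` for `i < r` and no other entries. -/
noncomputable def kostka : ℕ → (ℕ →₀ ℕ) → YoungDiagram → ℕ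
  | 0, _, F => if F = ⊥ then 1 else 0
  | r + 1, c, F => ∑ C ∈ diagramsLE F.card, if IsHorizontalStrip C F (c r) then kostka r c C else 0

theorem kostka_congr {r : ℕ} {c c' : ℕ →₀ ℕ} (h : ∀ i < r, c i = c' i) (F : YoungDiagram) :
    kostka r c F = kostka r c' F := by
  induction r generalizing F with
  | zero => rfl
  | succ r ih =>
    simp only [kostka, h r r.lt_succ_self, ih fun i hi => h i (hi.trans r.lt_succ_self)]

theorem kostka_succ {r k : ℕ} {c : ℕ →₀ ℕ} {F : YoungDiagram} (h : F.card = k + c r) :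
    kostka (r + 1) c F = ∑ C ∈ diagrams k, if Interlace C F then kostka r c C else 0 := by
  rw [sum_diagrams (N := F.card) (by omega), kostka]
  refine sum_congr rfl fun C _ => ?_
  rw [isHorizontalStrip_iff, h, add_left_inj]
  split_ifs <;> first | rfl | tauto

theorem sum_antidiagonal_add_single {c : ℕ →₀ ℕ} {r : ℕ} (hr : c r = 0) (m : ℕ)
    (f : (ℕ →₀ ℕ) × (ℕ →₀ ℕ) → ℕ) :
    ∑ p ∈ antidiagonal (c + Finsupp.single r m), f p =
      ∑ p ∈ antidiagonal c, ∑ q ∈ antidiagonal m,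
        f (p.1 + Finsupp.single r q.1, p.2 + Finsupp.single r q.2) := by
  rw [← sum_product']
  symm
  refine sum_bij' (fun p _ => (p.1.1 + Finsupp.single r p.2.1, p.1.2 + Finsupp.single r p.2.2))
    (fun p _ => ((p.1.erase r, p.2.erase r), (p.1 r, p.2 r))) ?_ ?_ ?_ ?_ (fun _ _ => rfl)
  · rintro ⟨⟨x, l⟩, a, b⟩ h
    simp only [mem_product, HasAntidiagonal.mem_antidiagonal] at h ⊢
    rw [← h.1, ← h.2, Finsupp.single_add]
    abel
  · rintro ⟨x, l⟩ h
    simp only [mem_product, HasAntidiagonal.mem_antidiagonal] at h ⊢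
    constructor
    · ext i
      have := DFunLike.congr_fun h i
      by_cases hi : i = r
      · subst hi; simp [hr]
      · simpa [Finsupp.erase_ne hi, Finsupp.single_apply, Ne.symm hi] using this
    · have := DFunLike.congr_fun h r
      simpa [hr] using this
  · rintro ⟨⟨x, l⟩, a, b⟩ h
    simp only [mem_product, HasAntidiagonal.mem_antidiagonal] at h
    have := DFunLike.congr_fun h.1 r
    rw [Finsupp.add_apply, hr] at this
    have hx : x r = 0 := by omega
    have hl : l r = 0 := by omega
    have e : ∀ (y : ℕ →₀ ℕ) (a : ℕ), y r = 0 → (y + Finsupp.single r a).erase r = y := by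
      intro y a hy
      ext i
      by_cases hi : i = r
      · subst hi; simp [hy]
      · simp [Finsupp.erase_ne hi]
    simp [e, hx, hl]
  · rintro ⟨x, l⟩ _
    simp only [Finsupp.erase_add_single]

/-- Removing a horizontal strip from the shape, summed over tableaux, amounts to removing entries
from the content. -/
theorem sum_interlace_kostka (r : ℕ) (c : ℕ →₀ ℕ) (hc : ∀ i, r ≤ i → c i = 0) (j : ℕ)
    (C : YoungDiagram) (hC : C.card + j = c.degree) :
    ∑ F ∈ diagrams c.degree, (if Interlace C F then kostka r c F else 0) =
      ∑ p ∈ antidiagonal c, if p.2.degree = j then kostka r p.1 C else 0 := by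
  induction r generalizing c j C with
  | zero =>
    obtain rfl : c = 0 := Finsupp.ext fun i => hc i (Nat.zero_le i)
    simp only [map_zero, Nat.add_eq_zero_iff] at hC
    obtain ⟨hC, rfl⟩ := hC
    obtain rfl := eq_bot_of_card hC
    have : Interlace ⊥ ⊥ := (isHorizontalStrip_iff (m := 0)).1
      ⟨le_rfl, by simp, fun j => Nat.le_succ _⟩ |>.2
    rw [Finsupp.antidiagonal_zero, sum_singleton, map_zero, diagrams_zero, sum_singleton]
    simp [kostka, this]
  | succ r ih =>
    obtain ⟨c, m, hr, hc', rfl⟩ : ∃ (c₀ : ℕ →₀ ℕ) (m : ℕ), c₀ r = 0 ∧ (∀ i, r ≤ i → c₀ i = 0) ∧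
        c = c₀ + Finsupp.single r m := by
      refine ⟨c.erase r, c r, by simp, fun i hi => ?_, (Finsupp.erase_add_single r c).symm⟩
      by_cases h : i = r
      · simp [h]
      · rw [Finsupp.erase_ne h]
        exact hc i (by omega)
    have hdeg : (c + Finsupp.single r m).degree = c.degree + m := by simp
    rw [hdeg] at hC ⊢
    have hK : ∀ (x : ℕ →₀ ℕ) (a : ℕ) (A : YoungDiagram),
        kostka r (x + Finsupp.single r a) A = kostka r x A := fun x a A =>
      kostka_congr (fun i hi => by simp [hi.ne']) A
    -- Both sides count pairs of a tableau with content `x ≤ c` and a horizontal strip inside `C`.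
    trans ∑ A ∈ diagramsLE C.card, ∑ p ∈ antidiagonal c,
      if (Interlace A C ∧ p.2.degree ≤ j) ∧ A.card = p.1.degree then kostka r p.1 A else 0
    · have h1 : ∀ F ∈ diagrams (c.degree + m),
          (if Interlace C F then kostka (r + 1) (c + Finsupp.single r m) F else 0) =
          ∑ B ∈ diagrams c.degree,
            if Interlace C F ∧ Interlace B F then kostka r c B else 0 := by
        intro F hF
        rw [kostka_succ (k := c.degree) (by simp [mem_diagrams.1 hF, hr])]
        split_ifs with h
        · simp [h, hK]
        · simp [h]
      have h2 : ∀ B ∈ diagrams c.degree,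
          ∑ F ∈ diagrams (c.degree + m),
            (if Interlace C F ∧ Interlace B F then kostka r c B else 0) =
          ∑ A ∈ diagramsLE C.card,
            if (Interlace A C ∧ c.degree ≤ A.card + j) ∧ Interlace A B then kostka r c B else 0 := by
        intro B hB
        rw [mem_diagrams] at hB
        rw [← sum_filter, ← sum_filter, sum_const, sum_const, ← hC,
          card_interlace_comm (by omega : C.card + j = B.card + m), hB]
        congr 2
        ext A
        simp only [mem_filter]
        tauto
      rw [sum_congr rfl h1, sum_comm, sum_congr rfl h2, sum_comm]
      refine sum_congr rfl fun A _ => ?_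
      by_cases hA : Interlace A C ∧ c.degree ≤ A.card + j
      · simp only [hA, true_and, ite_and]
        by_cases hle : A.card ≤ c.degree
        · rw [ih c hc' (c.degree - A.card) A (by omega)]
          refine sum_congr rfl fun p hp => ?_
          have h3 : p.1.degree + p.2.degree = c.degree := by
            rw [← map_add, HasAntidiagonal.mem_antidiagonal.1 hp]
          have := hA.2
          split_ifs <;> first | rfl | omega
        · rw [sum_eq_zero, sum_eq_zero]
          · intro p hp
            have h3 : p.1.degree + p.2.degree = c.degree := by
              rw [← map_add, HasAntidiagonal.mem_antidiagonal.1 hp]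
            split_ifs <;> first | rfl | omega
          · intro B hB
            rw [if_neg]
            intro h4
            have := card_mono_diagram h4.le
            rw [mem_diagrams.1 hB] at this
            omega
      · have : ∀ p ∈ antidiagonal c, ¬ ((Interlace A C ∧ p.2.degree ≤ j) ∧
            A.card = p.1.degree) := by
          rintro p hp ⟨⟨h4, h5⟩, h6⟩
          have h3 : p.1.degree + p.2.degree = c.degree := by
            rw [← map_add, HasAntidiagonal.mem_antidiagonal.1 hp]
          exact hA ⟨h4, by omega⟩
        rw [sum_eq_zero, sum_eq_zero]
        · exact fun p hp => if_neg (this p hp)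
        · exact fun B _ => if_neg fun h => hA h.1
    · rw [sum_antidiagonal_add_single hr, sum_comm]
      refine sum_congr rfl fun p hp => ?_
      have h3 : p.1.degree + p.2.degree = c.degree := by
        rw [← map_add, HasAntidiagonal.mem_antidiagonal.1 hp]
      have hp1 : p.1 r = 0 := by
        have := DFunLike.congr_fun (HasAntidiagonal.mem_antidiagonal.1 hp) r
        rw [Finsupp.add_apply, hr] at this
        omega
      simp only [map_add, Finsupp.degree_single]
      by_cases hj : p.2.degree ≤ j ∧ j ≤ p.2.degree + m
      · rw [sum_eq_single (m - (j - p.2.degree), j - p.2.degree)]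
        · rw [if_pos (by dsimp only; omega), kostka_succ (k := p.1.degree) (by simp [hp1]; omega),
            sum_diagrams (N := C.card) (by omega)]
          refine sum_congr rfl fun A _ => ?_
          simp only [hK, hj.1, and_true]
          split_ifs <;> first | rfl | tauto
        · rintro ⟨a, b⟩ hab hne
          rw [HasAntidiagonal.mem_antidiagonal] at hab
          rw [if_neg]
          intro h
          exact hne (Prod.ext (by dsimp only at *; omega) (by dsimp only at *; omega))
        · intro h
          exact absurd (HasAntidiagonal.mem_antidiagonal.2 (by dsimp only; omega)) h
      · rw [sum_eq_zero, sum_eq_zero]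
        · rintro ⟨a, b⟩ hab
          rw [HasAntidiagonal.mem_antidiagonal] at hab
          rw [if_neg]
          dsimp only at *
          omega
        · intro A hA
          rw [if_neg]
          rintro ⟨⟨h4, h5⟩, h6⟩
          have := card_mono_diagram h4.le
          omega

/-- The inner products of the permutation characters on colourings in terms of Kostka numbers. -/
theorem ip_permChar_permChar (r s n : ℕ) (d c : ℕ →₀ ℕ) (hd : ∀ i, r ≤ i → d i = 0)
    (hc : ∀ i, s ≤ i → c i = 0) (hdn : d.degree = n) (hcn : c.degree = n) :
    ip _ (permChar (Fin n) d) (permChar (Fin n) c) =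
      ((∑ F ∈ diagrams n, kostka r d F * kostka s c F : ℕ) : ℝ) := by
  induction r generalizing d c n with
  | zero =>
    obtain rfl : d = 0 := Finsupp.ext fun i => hd i (Nat.zero_le i)
    rw [map_zero] at hdn
    subst hdn
    obtain rfl := (Finsupp.degree_eq_zero_iff c).1 hcn
    have h1 : kostka s 0 ⊥ = 1 := by
      clear hc
      induction s with
      | zero => simp [kostka]
      | succ s ih =>
        have : Interlace ⊥ ⊥ := (isHorizontalStrip_iff (m := 0)).1
          ⟨le_rfl, by simp, fun j => Nat.le_succ _⟩ |>.2
        rw [kostka_succ (k := 0) rfl, diagrams_zero, sum_singleton, if_pos this, ih]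
    have h2 : ∀ g, permChar (Fin 0) 0 g = 1 := by
      intro g
      have := sum_permChar (α := Fin 0) 0 (by simp)
      rw [Fintype.sum_unique] at this
      rw [Subsingleton.elim g default, this]
      simp
    rw [ip_apply, diagrams_zero, sum_singleton, h1]
    simp [h2, kostka]
  | succ r ih =>
    obtain ⟨d, m, hr, hd', rfl⟩ : ∃ (d₀ : ℕ →₀ ℕ) (m : ℕ), d₀ r = 0 ∧ (∀ i, r ≤ i → d₀ i = 0) ∧
        d = d₀ + Finsupp.single r m := by
      refine ⟨d.erase r, d r, by simp, fun i hi => ?_, (Finsupp.erase_add_single r d).symm⟩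
      by_cases h : i = r
      · simp [h]
      · rw [Finsupp.erase_ne h]
        exact hd i (by omega)
    obtain rfl : d.degree + m = n := by rw [← hdn]; simp
    have hK : ∀ A : YoungDiagram, kostka r (d + Finsupp.single r m) A = kostka r d A := fun A =>
      kostka_congr (fun i hi => by simp [hi.ne']) A
    have h1 : ∀ p ∈ antidiagonal c, (if p.2.degree = m then
        ip _ (permChar (Fin d.degree) d) (permChar (Fin d.degree) p.1) else 0) =
        ((if p.2.degree = m then
          ∑ C ∈ diagrams d.degree, kostka r d C * kostka s p.1 C else 0 : ℕ) : ℝ) := by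
      intro p hp
      have hp' := HasAntidiagonal.mem_antidiagonal.1 hp
      have h3 : p.1.degree + p.2.degree = c.degree := by rw [← map_add, hp']
      split_ifs with h
      · refine ih _ d p.1 hd' (fun i hi => ?_) rfl (by omega)
        have := DFunLike.congr_fun hp' i
        rw [Finsupp.add_apply, hc i hi] at this
        omega
      · simp
    rw [← pieriMap_permChar hr rfl, ip_pieriMap_permChar, sum_congr rfl h1, ← Nat.cast_sum,
      Nat.cast_inj]
    have h2 : ∀ F ∈ diagrams (d.degree + m),
        kostka (r + 1) (d + Finsupp.single r m) F * kostka s c F =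
        ∑ C ∈ diagrams d.degree, if Interlace C F then kostka r d C * kostka s c F else 0 := by
      intro F hF
      rw [kostka_succ (k := d.degree) (by simp [mem_diagrams.1 hF, hr]), sum_mul]
      refine sum_congr rfl fun C _ => ?_
      rw [hK]; split_ifs <;> simp
    have h4 : ∀ C ∈ diagrams d.degree, ∑ F ∈ diagrams (d.degree + m),
        (if Interlace C F then kostka r d C * kostka s c F else 0) =
        ∑ p ∈ antidiagonal c, if p.2.degree = m then kostka r d C * kostka s p.1 C else 0 := by
      intro C hC
      rw [mem_diagrams] at hC
      have := sum_interlace_kostka s c hc m C (by omega)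
      rw [hcn] at this
      simp only [← mul_ite_zero, ← mul_sum, this]
    rw [sum_congr rfl h2, sum_comm, sum_congr rfl h4, sum_comm]
    refine sum_congr rfl fun p _ => ?_
    split_ifs <;> simp

end Kostka

/-! ### Triangularity -/

section Triangularity

open Finset
open scoped Classical

/-- The weight of a content, the sum of all colours. -/
noncomputable def wt : (ℕ →₀ ℕ) →+ ℕ where
  toFun c := c.sum fun i a => i * a
  map_zero' := Finsupp.sum_zero_index
  map_add' _ _ := Finsupp.sum_add_index' (fun _ => mul_zero _) fun _ _ _ => mul_add _ _ _

theorem wt_single (i a : ℕ) : wt (Finsupp.single i a) = i * a :=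
  Finsupp.sum_single_index (mul_zero _)

theorem wt_eq_sum_range {c : ℕ →₀ ℕ} {r : ℕ} (hc : ∀ i, r ≤ i → c i = 0) :
    wt c = ∑ i ∈ range r, i * c i := by
  refine Finset.sum_subset (fun i hi => ?_) fun i _ hi => ?_
  · rw [mem_range]
    by_contra! h
    exact Finsupp.mem_support_iff.1 hi (hc i h)
  · rw [Finsupp.notMem_support_iff.1 hi]; exact mul_zero _

theorem colLen_zero_le {D : YoungDiagram} {N : ℕ} (h : ∀ i, N ≤ i → D.rowLen i = 0) :
    D.colLen 0 ≤ N := by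
  by_contra! hlt
  have := YoungDiagram.mem_iff_lt_rowLen.1 (YoungDiagram.mem_iff_lt_colLen.2 hlt)
  rw [h _ le_rfl] at this
  omega

/-- Adding `a` boxes to `C` within the rows `0, …, r` raises the weight by at most `r * a`, with
equality only if all of them are put into row `r`. -/
theorem sum_mul_rowLen_le {C F : YoungDiagram} (h : C ≤ F) {r a : ℕ} (ha : C.card + a = F.card)
    (hF : ∀ i, r + 1 ≤ i → F.rowLen i = 0) :
    ∑ i ∈ range (r + 1), i * F.rowLen i ≤ ∑ i ∈ range (r + 1), i * C.rowLen i + r * a ∧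
    (∑ i ∈ range (r + 1), i * F.rowLen i = ∑ i ∈ range (r + 1), i * C.rowLen i + r * a →
      ∀ i < r, F.rowLen i = C.rowLen i) := by
  have hle := le_iff_rowLen.1 h
  have h1 := sum_rowLen_eq_card F (colLen_zero_le hF)
  have h2 := sum_rowLen_eq_card C (N := r + 1) (colLen_zero_le fun i hi =>
    Nat.le_zero.1 ((hle i).trans (hF i hi).le))
  have h3 : ∀ i ∈ range (r + 1), i * F.rowLen i + r * C.rowLen i ≤
      i * C.rowLen i + r * F.rowLen i := by
    intro i hi
    obtain ⟨x, hx⟩ := Nat.exists_eq_add_of_le (hle i)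
    have : i * x ≤ r * x := Nat.mul_le_mul_right _ (Nat.lt_succ_iff.1 (mem_range.1 hi))
    rw [hx, mul_add, mul_add]
    omega
  have h4 := sum_le_sum h3
  have h5 : r * F.card = r * C.card + r * a := by rw [← ha, mul_add]
  refine ⟨?_, fun heq i hi => ?_⟩
  · rw [sum_add_distrib, sum_add_distrib, ← mul_sum, ← mul_sum, h1, h2] at h4
    omega
  · have h6 := (sum_eq_sum_iff_of_le h3).1 (by
      rw [sum_add_distrib, sum_add_distrib, ← mul_sum, ← mul_sum, h1, h2]
      omega) i (mem_range.2 (by omega))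
    obtain ⟨x, hx⟩ := Nat.exists_eq_add_of_le (hle i)
    rw [hx, mul_add, mul_add] at h6
    have h7 : i * x = r * x := by omega
    rcases Nat.eq_zero_or_pos x with h0 | h0
    · omega
    · have := Nat.eq_of_mul_eq_mul_right h0 h7
      omega

/-- Entries in row `i` of a semistandard tableau are at least `i`. Hence the weight of the content
is at least that of the shape, with equality only if all entries equal their row index. -/
theorem kostka_ne_zero {r : ℕ} {c : ℕ →₀ ℕ} {F : YoungDiagram} (h : kostka r c F ≠ 0) :
    (∀ i, r ≤ i → F.rowLen i = 0) ∧
      ∑ i ∈ range r, i * F.rowLen i ≤ ∑ i ∈ range r, i * c i ∧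
      (∑ i ∈ range r, i * F.rowLen i = ∑ i ∈ range r, i * c i → ∀ i < r, F.rowLen i = c i) := by
  induction r generalizing F with
  | zero =>
    have : F = ⊥ := by
      by_contra h0
      exact h (if_neg h0)
    subst this
    refine ⟨fun i _ => rowLen_eq_zero_of_card_le (Nat.zero_le _), by simp, by simp⟩
  | succ r ih =>
    obtain ⟨C, -, hC⟩ := exists_ne_zero_of_sum_ne_zero h
    obtain ⟨hs, hK⟩ : IsHorizontalStrip C F (c r) ∧ kostka r c C ≠ 0 := by
      by_cases hs : IsHorizontalStrip C F (c r)
      · exact ⟨hs, by rwa [if_pos hs] at hC⟩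
      · rw [if_neg hs] at hC; exact absurd rfl hC
    rw [isHorizontalStrip_iff] at hs
    obtain ⟨h1, h2, h3⟩ := ih hK
    have hF : ∀ i, r + 1 ≤ i → F.rowLen i = 0 := by
      intro i hi
      obtain ⟨i, rfl⟩ : ∃ i', i = i' + 1 := ⟨i - 1, by omega⟩
      have := (hs.2 i).1
      rw [h1 i (by omega)] at this
      omega
    obtain ⟨h4, h5⟩ := sum_mul_rowLen_le hs.2.le hs.1 hF
    rw [sum_range_succ (fun i => i * C.rowLen i), h1 r le_rfl, mul_zero, add_zero] at h4 h5
    refine ⟨hF, ?_, fun heq => ?_⟩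
    · rw [sum_range_succ (fun i => i * c i)]
      exact h4.trans (Nat.add_le_add_right h2 _)
    · rw [sum_range_succ (fun i => i * c i)] at heq
      have h6 := h3 (by omega)
      have h7 := h5 (by omega)
      intro i hi
      rcases Nat.lt_succ_iff_lt_or_eq.1 hi with hi | rfl
      · rw [h7 i hi, h6 i hi]
      · have e1 := sum_rowLen_eq_card F (colLen_zero_le hF)
        have e2 := sum_rowLen_eq_card C (N := i + 1) (colLen_zero_le fun l hl => h1 l (by omega))
        have e3 : ∑ l ∈ range i, F.rowLen l = ∑ l ∈ range i, C.rowLen l :=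
          sum_congr rfl fun l hl => h7 l (mem_range.1 hl)
        rw [sum_range_succ, e3] at e1
        rw [sum_range_succ, h1 i le_rfl, add_zero] at e2
        have := hs.1
        omega

/-- Diagonal Kostka numbers are `1`: the only semistandard filling of `F` whose content is the list
of row lengths of `F` has row `i` filled with the letter `i`. -/
theorem kostka_eq_one {r : ℕ} {c : ℕ →₀ ℕ} {F : YoungDiagram} (h : ∀ i < r, F.rowLen i = c i)
    (h0 : ∀ i, r ≤ i → F.rowLen i = 0) : kostka r c F = 1 := by
  induction r generalizing F with
  | zero =>
    refine if_pos (ext_rowLen fun i => ?_)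
    rw [h0 i (Nat.zero_le i), rowLen_eq_zero_of_card_le (Nat.zero_le _)]
  | succ r ih =>
    let f : ℕ → ℕ := fun i => if i < r then F.rowLen i else 0
    have hf : Antitone f := antitone_nat_of_succ_le fun i => by
      have : F.rowLen (i + 1) ≤ F.rowLen i := F.rowLen_anti _ _ i.le_succ
      simp only [f]; split_ifs <;> omega
    have hfr : ∀ i, r ≤ i → f i = 0 := fun i hi => if_neg (by omega)
    let C := ofRows f hf r hfr
    have hC : ∀ i, C.rowLen i = f i := rowLen_ofRows f hf r hfr
    have hCF : Interlace C F := fun i => by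
      rw [hC]
      have : F.rowLen (i + 1) ≤ F.rowLen i := F.rowLen_anti _ _ i.le_succ
      by_cases hi : i < r
      · simp only [f, if_pos hi]; omega
      · have := h0 (i + 1) (by omega)
        simp only [f, if_neg hi]; omega
    have hcard : F.card = C.card + c r := by
      rw [← sum_rowLen_eq_card F (colLen_zero_le h0), ← sum_rowLen_eq_card C (N := r + 1)
        (colLen_zero_le fun l hl => by rw [hC]; exact hfr l (by omega)), sum_range_succ,
        sum_range_succ, hC, hfr r le_rfl, h r r.lt_succ_self, add_zero]
      congr 1
      refine sum_congr rfl fun l hl => ?_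
      rw [hC]
      exact (if_pos (mem_range.1 hl)).symm
    rw [kostka_succ hcard, sum_eq_single C]
    · rw [if_pos hCF]
      refine ih (fun i hi => ?_) fun i hi => by rw [hC]; exact hfr i hi
      rw [hC, ← h i (by omega)]
      exact if_pos hi
    · intro C' hC' hne
      rw [mem_diagrams] at hC'
      by_contra hK
      have hs : Interlace C' F := by
        by_contra hs
        exact hK (if_neg hs)
      rw [if_pos hs] at hK
      obtain ⟨h1, h2, h3⟩ := kostka_ne_zero hK
      obtain ⟨h4, -⟩ := sum_mul_rowLen_le (a := c r) hs.le (by omega) h0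
      rw [sum_range_succ, h r r.lt_succ_self, sum_range_succ, h1 r le_rfl, mul_zero, add_zero] at h4
      have h5 : ∑ i ∈ range r, i * F.rowLen i = ∑ i ∈ range r, i * c i :=
        sum_congr rfl fun i hi => by rw [h i ((mem_range.1 hi).trans r.lt_succ_self)]
      have h6 := h3 (by omega)
      refine hne (ext_rowLen fun i => ?_)
      rw [hC]
      by_cases hi : i < r
      · rw [h6 i hi, ← h i (by omega)]
        exact (if_pos hi).symm
      · rw [h1 i (by omega), hfr i (by omega)]
    · exact fun hn => absurd (mem_diagrams.2 rfl) hn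

/-- The content of `a` letters with the distinct colours `0, …, a - 1`. -/
noncomputable def initialContent (a : ℕ) : ℕ →₀ ℕ := ∑ i ∈ range a, Finsupp.single i 1

theorem initialContent_apply (a i : ℕ) : initialContent a i = if i < a then 1 else 0 := by
  simp [initialContent, Finsupp.finsetSum_apply, Finsupp.single_apply]

theorem wt_initialContent (a : ℕ) : wt (initialContent a) = ∑ i ∈ range a, i := by
  simp [initialContent, map_sum, wt_single]

theorem degree_initialContent (a : ℕ) : (initialContent a).degree = a := by
  simp [initialContent, map_sum]

theorem sum_range_id_le_sum {a : ℕ} {S : Finset ℕ} (hS : #S = a) :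
    ∑ i ∈ range a, i ≤ ∑ i ∈ S, i ∧ (∑ i ∈ S, i ≤ ∑ i ∈ range a, i → S = range a) := by
  induction a generalizing S with
  | zero => rw [card_eq_zero] at hS; subst hS; simp
  | succ a ih =>
    have hne : S.Nonempty := card_pos.1 (by omega)
    set b := S.max' hne with hb
    have hmem : b ∈ S := S.max'_mem hne
    obtain ⟨h1, h2⟩ := ih (S := S.erase b) (by rw [card_erase_of_mem hmem]; omega)
    have hsub : S ⊆ range (b + 1) := fun i hi =>
      mem_range.2 (Nat.lt_succ_of_le (S.le_max' i hi))
    have hab : a ≤ b := by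
      have := card_le_card hsub
      rw [card_range] at this
      omega
    rw [← add_sum_erase S _ hmem, sum_range_succ]
    refine ⟨by omega, fun h => ?_⟩
    have hba : b = a := by omega
    have h3 := h2 (by omega)
    rw [← insert_erase hmem, h3, hba, range_add_one]

/-- Among contents of degree `a` with distinct colours, the weight is minimal for the first `a`
colours. -/
theorem wt_le_of_le_one {l : ℕ →₀ ℕ} (hl : ∀ i, l i ≤ 1) :
    ∑ i ∈ range l.degree, i ≤ wt l ∧
      (wt l ≤ ∑ i ∈ range l.degree, i → l = initialContent l.degree) := by
  have h1 : ∀ i ∈ l.support, l i = 1 := fun i hi => by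
    have := Finsupp.mem_support_iff.1 hi
    have := hl i
    omega
  have hdeg : #l.support = l.degree := by
    rw [Finsupp.degree_apply, sum_congr rfl h1, card_eq_sum_ones]
  have hwt : wt l = ∑ i ∈ l.support, i :=
    sum_congr rfl fun i hi => by
      change i * l i = i
      rw [h1 i hi, mul_one]
  obtain ⟨h2, h3⟩ := sum_range_id_le_sum hdeg
  rw [hwt]
  refine ⟨h2, fun h => Finsupp.ext fun i => ?_⟩
  have h4 : i < l.degree ↔ i ∈ l.support := by rw [h3 h, mem_range]
  rw [initialContent_apply]
  split_ifs with hi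
  · exact h1 i (h4.1 hi)
  · exact Finsupp.notMem_support_iff.1 fun h5 => hi (h4.2 h5)

/-- The pairing of twisted and untwisted permutation characters counts `0`-`1` matrices with given
margins; if the weight of the column content is minimal there is at most one. -/
theorem ip_sgn_permChar_permChar (r n : ℕ) (d c : ℕ →₀ ℕ) (hd : ∀ i, r ≤ i → d i = 0)
    (hdn : d.degree = n) (hcn : c.degree = n)
    (hw : wt c ≤ wt (∑ j ∈ range r, initialContent (d j))) :
    ip _ (sgnChar (Fin n) * permChar (Fin n) d) (permChar (Fin n) c) =
      if c = ∑ j ∈ range r, initialContent (d j) then 1 else 0 := by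
  induction r generalizing d c n with
  | zero =>
    obtain rfl : d = 0 := Finsupp.ext fun i => hd i (Nat.zero_le i)
    rw [map_zero] at hdn
    subst hdn
    obtain rfl := (Finsupp.degree_eq_zero_iff c).1 hcn
    have h2 : ∀ g, permChar (Fin 0) 0 g = 1 := by
      intro g
      have := sum_permChar (α := Fin 0) 0 (by simp)
      rw [Fintype.sum_unique] at this
      rw [Subsingleton.elim g default, this]
      simp
    rw [ip_apply]
    simp [h2, sgnChar]
  | succ r ih =>
    obtain ⟨d, m, hr, hd', rfl⟩ : ∃ (d₀ : ℕ →₀ ℕ) (m : ℕ), d₀ r = 0 ∧ (∀ i, r ≤ i → d₀ i = 0) ∧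
        d = d₀ + Finsupp.single r m := by
      refine ⟨d.erase r, d r, by simp, fun i hi => ?_, (Finsupp.erase_add_single r d).symm⟩
      by_cases h : i = r
      · simp [h]
      · rw [Finsupp.erase_ne h]
        exact hd i (by omega)
    obtain rfl : d.degree + m = n := by rw [← hdn]; simp
    set S := ∑ j ∈ range r, initialContent (d j) with hS
    have hsum : ∑ j ∈ range (r + 1), initialContent ((d + Finsupp.single r m) j) =
        S + initialContent m := by
      rw [sum_range_succ, hS]
      congr 1
      · refine sum_congr rfl fun j hj => ?_
        rw [Finsupp.add_apply, Finsupp.single_eq_of_ne (mem_range.1 hj).ne, add_zero]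
      · simp [hr]
    rw [hsum, map_add, wt_initialContent] at hw
    rw [hsum, ← pieriMap_permChar hr rfl, ip_sgn_pieriMap_permChar]
    have h1 : ∀ p ∈ antidiagonal c, (if p.2.degree = m ∧ ∀ i, p.2 i ≤ 1 then
        ip _ (sgnChar _ * permChar (Fin d.degree) d) (permChar (Fin d.degree) p.1) else 0) =
        if p = (S, initialContent m) then 1 else 0 := by
      intro p hp
      have hp' := HasAntidiagonal.mem_antidiagonal.1 hp
      have h3 : p.1.degree + p.2.degree = c.degree := by rw [← map_add, hp']
      have h4 : wt p.1 + wt p.2 = wt c := by rw [← map_add, hp']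
      by_cases h : p.2.degree = m ∧ ∀ i, p.2 i ≤ 1
      · obtain ⟨h5, h6⟩ := wt_le_of_le_one h.2
        rw [h.1] at h5 h6
        rw [if_pos h, ih _ d p.1 hd' rfl (by omega) (by rw [← hS]; omega)]
        refine if_congr ⟨fun h7 => ?_, fun h7 => by rw [h7]⟩ rfl rfl
        refine Prod.ext h7 (h6 ?_)
        rw [h7, ← hS] at h4
        omega
      · rw [if_neg h, if_neg]
        rintro rfl
        refine h ⟨degree_initialContent m, fun i => ?_⟩
        dsimp only
        rw [initialContent_apply]
        split_ifs <;> omega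
    rw [sum_congr rfl h1, sum_ite_eq']
    simp only [HasAntidiagonal.mem_antidiagonal, eq_comm]

/-- The columns of a Young diagram, filled with their row indices. -/
theorem sum_initialContent_colLen (E : YoungDiagram) {r : ℕ} (hr : E.card ≤ r) :
    ∑ j ∈ range r, initialContent (rowContent E.transpose j) = rowContent E := by
  ext i
  rw [Finsupp.finsetSum_apply, rowContent_apply]
  simp only [rowContent_apply, YoungDiagram.rowLen_transpose, initialContent_apply,
    ← YoungDiagram.mem_iff_lt_colLen, YoungDiagram.mem_iff_lt_rowLen]
  rw [← card_filter]
  have : {j ∈ range r | j < E.rowLen i} = range (E.rowLen i) := by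
    ext j
    simp only [mem_filter, mem_range, and_iff_right_iff_imp]
    intro hj
    have h1 := YoungDiagram.mem_iff_lt_colLen.1 (YoungDiagram.mem_iff_lt_rowLen.2 hj)
    by_contra! hlt
    have h2 := rowLen_eq_zero_of_card_le (D := E.transpose) (i := j)
      (by rw [card_transpose]; omega)
    rw [YoungDiagram.rowLen_transpose] at h2
    omega
  rw [this, card_range]

end Triangularity

/-! ### The irreducible representations `σ_D` -/

section Sigma

open Finset Representation
open scoped Classical

theorem rowContent_injective {D E : YoungDiagram} (h : rowContent D = rowContent E) : D = E :=
  ext_rowLen fun i => DFunLike.congr_fun h i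

theorem rowContent_eq_zero {n : ℕ} (D : Diagram n) {i : ℕ} (hi : n ≤ i) : rowContent D.1 i = 0 :=
  rowLen_eq_zero_of_card_le (D.2.le.trans hi)

theorem degree_rowContent_diagram {n : ℕ} (D : Diagram n) : (rowContent D.1).degree = n :=
  (degree_rowContent D.1).trans D.2

/-- The twisted and the plain Young module of `E` share exactly one component, and those of `E`
and `F` share none when `F ≠ E` has no larger weight. -/
theorem finrank_twistedYoungModule_youngModule {n : ℕ} (E F : Diagram n)
    (h : wt (rowContent F.1) ≤ wt (rowContent E.1)) :
    Module.finrank ℂ (IntertwiningMap (twistedYoungModule E.transpose) (youngModule F)) =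
      if F = E then 1 else 0 := by
  have h1 := ip_chr (twistedYoungModule E.transpose) (youngModule F)
  have h2 : ∑ j ∈ range n, initialContent (rowContent E.transpose.1 j) = rowContent E.1 :=
    sum_initialContent_colLen E.1 E.2.le
  rw [chr_twistedYoungModule, chr_youngModule,
    ip_sgn_permChar_permChar n n _ _ (fun i hi => rowContent_eq_zero _ hi)
      (degree_rowContent_diagram _) (degree_rowContent_diagram _) (by rwa [h2]), h2] at h1
  have h3 : rowContent F.1 = rowContent E.1 ↔ F = E :=
    ⟨fun h => Subtype.ext (rowContent_injective h), fun h => by rw [h]⟩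
  simp only [h3] at h1
  rw [← Nat.cast_inj (R := ℝ), ← h1]
  split_ifs <;> simp

/-- The joint component is the image of the unique (up to scalars) intertwining map. -/
theorem exists_jointComponent_eq_range {n : ℕ} (D : Diagram n) :
    ∃ f : IntertwiningMap (twistedYoungModule D.transpose) (youngModule D),
      f ≠ 0 ∧ (∀ g, ∃ c : ℂ, g = c • f) ∧ jointComponent D = f.range := by
  have h1 := finrank_twistedYoungModule_youngModule D D le_rfl
  rw [if_pos rfl] at h1
  obtain ⟨f, hf, hall⟩ := finrank_eq_one_iff'.1 h1
  have hall' : ∀ g, ∃ c : ℂ, g = c • f := fun g => (hall g).imp fun c hc => hc.symm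
  refine ⟨f, hf, hall', Subrepresentation.toSubmodule_injective (le_antisymm ?_ ?_)⟩
  · refine iSup_le fun g => ?_
    obtain ⟨c, rfl⟩ := hall' g
    rintro _ ⟨a, rfl⟩
    exact ⟨c • a, map_smul f c a⟩
  · exact le_iSup (fun g : IntertwiningMap (twistedYoungModule D.transpose) (youngModule D) =>
      g.range.toSubmodule) f

theorem isIrreducible_sigma {n : ℕ} (D : Diagram n) : (sigma D).IsIrreducible := by
  obtain ⟨f, hf, hall, heq⟩ := exists_jointComponent_eq_range D
  rw [sigma, heq]
  exact isIrreducible_range f hf hall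

theorem exists_twistedYoungModule_sigma_ne_zero {n : ℕ} (D : Diagram n) :
    ∃ g : IntertwiningMap (twistedYoungModule D.transpose) (sigma D), g ≠ 0 := by
  obtain ⟨f, hf, -, heq⟩ := exists_jointComponent_eq_range D
  obtain ⟨p, hp⟩ := exists_leftInverse (subtypeMap (jointComponent D)) Subtype.val_injective
  refine ⟨p.comp f, fun h0 => hf (DFunLike.ext _ _ fun a => ?_)⟩
  have hmem : f a ∈ (jointComponent D).toSubmodule := by
    rw [heq]; exact ⟨a, rfl⟩
  have h1 : p (f a) = ⟨f a, hmem⟩ := hp ⟨f a, hmem⟩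
  have h2 : p (f a) = 0 :=
    congrArg (fun k : IntertwiningMap (twistedYoungModule D.transpose) (sigma D) => k a) h0
  rw [h2] at h1
  exact (congrArg Subtype.val h1).symm

theorem eq_of_equiv_of_wt_le {n : ℕ} {E F : Diagram n} (e : (sigma E).Equiv (sigma F))
    (h : wt (rowContent F.1) ≤ wt (rowContent E.1)) : F = E := by
  by_contra hne
  have h1 := finrank_twistedYoungModule_youngModule E F h
  rw [if_neg hne, Module.finrank_eq_zero_iff_of_free] at h1
  obtain ⟨g, hg⟩ := exists_twistedYoungModule_sigma_ne_zero E
  have h2 : (subtypeMap (jointComponent F)).comp (e.toIntertwiningMap.comp g) = 0 :=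
    Subsingleton.elim _ _
  refine hg (DFunLike.ext _ _ fun a => e.injective (Subtype.ext ?_))
  have h3 := congrArg
    (fun k : IntertwiningMap (twistedYoungModule E.transpose) (youngModule F) => k a) h2
  have h4 : e (0 : (jointComponent E).toSubmodule) = 0 := map_zero e.toIntertwiningMap
  exact h3.trans (congrArg Subtype.val h4).symm

theorem eq_of_nonempty_equiv {n : ℕ} {E F : Diagram n}
    (h : Nonempty ((sigma E).Equiv (sigma F))) : E = F := by
  obtain ⟨e⟩ := h
  rcases le_total (wt (rowContent F.1)) (wt (rowContent E.1)) with h | h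
  · exact (eq_of_equiv_of_wt_le e h).symm
  · exact eq_of_equiv_of_wt_le e.symm h

theorem ip_chr_sigma {n : ℕ} (E F : Diagram n) :
    ip _ (chr (sigma E)) (chr (sigma F)) = if E = F then 1 else 0 := by
  have := isIrreducible_sigma E
  have := isIrreducible_sigma F
  rw [ip_chr]
  split_ifs with h
  · subst h
    rw [IsIrreducible.finrank_intertwiningMap_self, Nat.cast_one]
  · have : IsEmpty ((sigma E).Equiv (sigma F)) :=
      not_nonempty_iff.1 fun h' => h (eq_of_nonempty_equiv h')
    rw [Module.finrank_zero_of_subsingleton, Nat.cast_zero]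

theorem one_le_ip_sigma_youngModule {n : ℕ} (D : Diagram n) :
    1 ≤ ip _ (chr (sigma D)) (chr (youngModule D)) := by
  rw [ip_chr, Nat.one_le_cast, Nat.one_le_iff_ne_zero]
  intro h0
  rw [Module.finrank_eq_zero_iff_of_free] at h0
  obtain ⟨g, hg⟩ := exists_twistedYoungModule_sigma_ne_zero D
  refine hg (DFunLike.ext _ _ fun a => Subtype.ext ?_)
  have h1 : subtypeMap (jointComponent D) = 0 := Subsingleton.elim _ _
  exact congrArg (fun k : IntertwiningMap (sigma D) (youngModule D) => k (g a)) h1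

end Sigma

/-! ### Unitriangular decompositions -/

section LinearAlgebra

open Finset

variable {G P : Type} [Group G] [Fintype G] [Fintype P] [DecidableEq P] {s : P → G → ℝ}

omit [DecidableEq P] in
theorem ip_sum_smul_left (k : P → ℝ) (v : G → ℝ) :
    ip G (∑ F, k F • s F) v = ∑ F, k F * ip G (s F) v := by
  simp

/-- A vector is determined by its coordinates in an orthonormal family if Parseval's identity
holds for them; lower bounds for the coordinates suffice. -/
theorem eq_sum_of_parseval (hs : ∀ E F, ip G (s E) (s F) = if E = F then 1 else 0) {k : P → ℝ}
    {v : G → ℝ} (hv : ip G v v = ∑ F, k F * k F) (hk : ∀ F, k F * k F ≤ k F * ip G (s F) v) :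
    v = ∑ F, k F • s F := by
  rw [← sub_eq_zero]
  apply eq_zero_of_ip_self_nonpos
  have h1 : ip G (∑ F, k F • s F) (∑ F, k F • s F) = ∑ F, k F * k F := by
    rw [ip_sum_smul_left]
    refine sum_congr rfl fun F _ => ?_
    rw [ip_comm, ip_sum_smul_left]
    simp [hs]
  have h2 : ∑ F, k F * k F ≤ ip G (∑ F, k F • s F) v := by
    rw [ip_sum_smul_left]
    exact sum_le_sum fun F _ => hk F
  have h3 := ip_comm v (∑ F, k F • s F)
  simp only [map_sub, LinearMap.sub_apply]
  rw [h1, h3, hv]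
  linarith

variable {y : P → G → ℝ} {K : P → P → ℝ} {w : P → ℕ}

/-- Inversion of a unitriangular system: if `y E = ∑ F, K F E • s F` and the products of `v` with
the `y E` are those of `∑ F, k F • s F` for orthonormal `s`, then `ip (s E) v = k E`. -/
theorem ip_eq_of_triangular (hK1 : ∀ E, K E E = 1) (hKw : ∀ F E, K F E ≠ 0 → F ≠ E → w F < w E)
    {N : ℕ} (hy : ∀ E, w E < N → y E = ∑ F, K F E • s F) {v : G → ℝ} {k : P → ℝ}
    (hv : ∀ E, ip G (y E) v = ∑ F, K F E * k F) (E : P) (hE : w E < N) : ip G (s E) v = k E := by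
  induction h : w E using Nat.strong_induction_on generalizing E with
  | _ a ih =>
    subst h
    have h1 := hv E
    rw [hy E hE, ip_sum_smul_left, ← add_sum_erase _ _ (mem_univ E),
      ← add_sum_erase _ (fun F => K F E * k F) (mem_univ E), hK1, one_mul, one_mul] at h1
    have h2 : ∑ F ∈ univ.erase E, K F E * ip G (s F) v = ∑ F ∈ univ.erase E, K F E * k F := by
      refine sum_congr rfl fun F hF => ?_
      by_cases h0 : K F E = 0
      · rw [h0, zero_mul, zero_mul]
      · have := hKw F E h0 (ne_of_mem_erase hF)
        rw [ih _ this F (this.trans hE) rfl]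
    rw [h2] at h1
    exact add_right_cancel h1

/-- If the Gram matrix of a family `y` factors through a unitriangular matrix `K`, and each `y E`
has a component at least `1` along `s E`, then `K` expresses `y` in the orthonormal family `s`. -/
theorem eq_sum_of_triangular (hs : ∀ E F, ip G (s E) (s F) = if E = F then 1 else 0)
    (hK1 : ∀ E, K E E = 1) (hKw : ∀ F E, K F E ≠ 0 → F ≠ E → w F < w E)
    (hgram : ∀ E E', ip G (y E) (y E') = ∑ F, K F E * K F E')
    (hys : ∀ E, 1 ≤ ip G (s E) (y E)) (E : P) : y E = ∑ F, K F E • s F := by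
  induction h : w E using Nat.strong_induction_on generalizing E with
  | _ a ih =>
    subst h
    refine eq_sum_of_parseval hs (hgram E E) fun F => ?_
    by_cases hFE : F = E
    · subst hFE
      rw [hK1, one_mul, one_mul]
      exact hys F
    by_cases h0 : K F E = 0
    · rw [h0, zero_mul, zero_mul]
    · rw [ip_eq_of_triangular hK1 hKw (fun E' hE' => ih _ hE' E' rfl) (fun E' => hgram E' E) F
        (hKw F E h0 hFE)]

end LinearAlgebra

/-! ### The decomposition of Young modules and Pieri's rule -/

section Pieri

open Finset Representation
open scoped Classical

instance (n : ℕ) : Finite (Diagram n) :=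
  Set.Finite.to_subtype ((finite_card_le n).subset fun D (hD : D.card = n) => hD.le)

noncomputable instance (n : ℕ) : Fintype (Diagram n) := Fintype.ofFinite _

theorem sum_diagrams_eq {M : Type} [AddCommMonoid M] (n : ℕ) (f : YoungDiagram → M) :
    ∑ F ∈ diagrams n, f F = ∑ F : Diagram n, f F.1 :=
  Finset.sum_subtype _ (fun _ => mem_diagrams) f

theorem kostka_self {n : ℕ} (D : Diagram n) : kostka n (rowContent D.1) D.1 = 1 :=
  kostka_eq_one (fun _ _ => rfl) fun _ hi => rowContent_eq_zero D hi

theorem wt_lt_of_kostka_ne_zero {n : ℕ} {F D : Diagram n}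
    (h : kostka n (rowContent D.1) F.1 ≠ 0) (hne : F ≠ D) :
    wt (rowContent F.1) < wt (rowContent D.1) := by
  obtain ⟨h1, h2, h3⟩ := kostka_ne_zero h
  rw [wt_eq_sum_range fun i hi => rowContent_eq_zero F hi,
    wt_eq_sum_range fun i hi => rowContent_eq_zero D hi]
  refine lt_of_le_of_ne h2 fun heq => hne (Subtype.ext (ext_rowLen fun i => ?_))
  by_cases hi : i < n
  · exact h3 heq i hi
  · exact (rowContent_eq_zero F (not_lt.1 hi)).trans (rowContent_eq_zero D (not_lt.1 hi)).symm

/-- Young's rule: the multiplicities of the `σ_F` in a Young module are Kostka numbers. -/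
theorem permChar_rowContent_eq_sum {n : ℕ} (D : Diagram n) :
    permChar (Fin n) (rowContent D.1) =
      ∑ F : Diagram n, (kostka n (rowContent D.1) F.1 : ℝ) • chr (sigma F) := by
  refine eq_sum_of_triangular (y := fun D : Diagram n => permChar (Fin n) (rowContent D.1))
    (K := fun F D => (kostka n (rowContent D.1) F.1 : ℝ)) (w := fun D => wt (rowContent D.1))
    ip_chr_sigma (fun E => by rw [kostka_self, Nat.cast_one])
    (fun F E h hne => wt_lt_of_kostka_ne_zero (Nat.cast_ne_zero.1 h) hne) (fun E E' => ?_)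
    (fun E => ?_) D
  · rw [ip_permChar_permChar n n n _ _ (fun i hi => rowContent_eq_zero E hi)
      (fun i hi => rowContent_eq_zero E' hi) (degree_rowContent_diagram E)
      (degree_rowContent_diagram E'), sum_diagrams_eq]
    push_cast
    rfl
  · rw [← chr_youngModule]
    exact one_le_ip_sigma_youngModule E

/-- Young's rule for colourings whose content is not weakly decreasing. -/
theorem permChar_eq_sum {n r : ℕ} {c : ℕ →₀ ℕ} (hc : ∀ i, r ≤ i → c i = 0) (hcn : c.degree = n) :
    permChar (Fin n) c = ∑ F : Diagram n, (kostka r c F.1 : ℝ) • chr (sigma F) := by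
  have hgram : ∀ E : Diagram n, ip _ (permChar (Fin n) (rowContent E.1)) (permChar (Fin n) c) =
      ∑ F : Diagram n, (kostka n (rowContent E.1) F.1 : ℝ) * (kostka r c F.1 : ℝ) := by
    intro E
    rw [ip_permChar_permChar n r n _ _ (fun i hi => rowContent_eq_zero E hi) hc
      (degree_rowContent_diagram E) hcn, sum_diagrams_eq]
    push_cast
    rfl
  refine eq_sum_of_parseval ip_chr_sigma ?_ fun F => ?_
  · rw [ip_permChar_permChar r r n _ _ hc hc hcn hcn, sum_diagrams_eq]
    push_cast
    rfl
  · rw [ip_eq_of_triangular (y := fun D : Diagram n => permChar (Fin n) (rowContent D.1))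
      (K := fun F D => (kostka n (rowContent D.1) F.1 : ℝ)) (w := fun D => wt (rowContent D.1))
      (fun E => by rw [kostka_self, Nat.cast_one])
      (fun F E h hne => wt_lt_of_kostka_ne_zero (Nat.cast_ne_zero.1 h) hne)
      (fun E _ => permChar_rowContent_eq_sum E) hgram F (Nat.lt_succ_self _)]

/-- Pieri's rule for characters. Both sides agree after summing against the unitriangular matrix
of Kostka numbers, since inducing a Young module gives a Young module again. -/
theorem pieriMap_chr_sigma {k : ℕ} (m : ℕ) (D : Diagram k) :
    pieriMap k m (chr (sigma D)) =
      ∑ G : Diagram (k + m), if Interlace D.1 G.1 then chr (sigma G) else 0 := by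
  set x : Diagram k → Equiv.Perm (Fin (k + m)) → ℝ := fun C => pieriMap k m (chr (sigma C)) -
    ∑ G : Diagram (k + m), if Interlace C.1 G.1 then chr (sigma G) else 0 with hx
  have h0 : ∀ E : Diagram k, ∑ C : Diagram k, (kostka k (rowContent E.1) C.1 : ℝ) • x C = 0 := by
    intro E
    have hr : rowContent E.1 k = 0 := rowContent_eq_zero E le_rfl
    have hdeg : (rowContent E.1).degree = k := degree_rowContent_diagram E
    have h1 := pieriMap_permChar (m := m) hr hdeg
    rw [permChar_rowContent_eq_sum E, map_sum,
      permChar_eq_sum (r := k + 1) (fun i hi => by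
        rw [Finsupp.add_apply, rowContent_eq_zero E (by omega),
          Finsupp.single_eq_of_ne (by omega), add_zero]) (by simp [hdeg])] at h1
    have h2 : ∀ G : Diagram (k + m),
        (kostka (k + 1) (rowContent E.1 + Finsupp.single k m) G.1 : ℝ) • chr (sigma G) =
        ∑ C : Diagram k, (kostka k (rowContent E.1) C.1 : ℝ) •
          if Interlace C.1 G.1 then chr (sigma G) else 0 := by
      intro G
      rw [kostka_succ (k := k) (by simp [G.2, hr]), sum_diagrams_eq, Nat.cast_sum, sum_smul]
      refine sum_congr rfl fun C _ => ?_
      rw [kostka_congr (c' := rowContent E.1) fun i hi => by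
        rw [Finsupp.add_apply, Finsupp.single_eq_of_ne hi.ne, add_zero]]
      split_ifs <;> simp
    rw [sum_congr rfl fun G _ => h2 G, sum_comm, ← sub_eq_zero, ← sum_sub_distrib] at h1
    rw [← h1]
    refine sum_congr rfl fun C _ => ?_
    rw [hx, smul_sub, map_smul, smul_sum]
  have h3 : ∀ E : Diagram k, x E = 0 := by
    intro E
    induction h : wt (rowContent E.1) using Nat.strong_induction_on generalizing E with
    | _ a ih =>
      subst h
      have h1 := h0 E
      rw [← add_sum_erase _ _ (mem_univ E), kostka_self, Nat.cast_one, one_smul,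
        sum_eq_zero fun C hC => ?_, add_zero] at h1
      · exact h1
      · by_cases hK : kostka k (rowContent E.1) C.1 = 0
        · rw [hK, Nat.cast_zero, zero_smul]
        · rw [ih _ (wt_lt_of_kostka_ne_zero hK (ne_of_mem_erase hC)) C rfl, smul_zero]
  exact sub_eq_zero.1 (h3 D)

theorem isHorizontalStrip_iff_interlace {k m : ℕ} (D : Diagram k) (E : Diagram (k + m)) :
    IsHorizontalStrip D.1 E.1 m ↔ Interlace D.1 E.1 := by
  rw [isHorizontalStrip_iff, D.2, E.2]
  exact and_iff_right rfl

theorem chr_pieriInd_eq_sum {k : ℕ} (D : Diagram k) (m : ℕ) :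
    chr (pieriInd D m) =
      ∑ E : {E : Diagram (k + m) // IsHorizontalStrip D.1 E.1 m}, chr (sigma E.1) := by
  rw [chr_pieriInd, pieriMap_chr_sigma, ← sum_filter]
  exact Finset.sum_subtype _ (fun E => by simp [isHorizontalStrip_iff_interlace])
    fun E => chr (sigma E)

theorem nonempty_pieriInd_equiv {k : ℕ} (D : Diagram k) (m : ℕ) :
    Nonempty ((pieriInd D m).Equiv (directSum
      fun E : {E : Diagram (k + m) // IsHorizontalStrip D.1 E.1 m} => sigma E.1)) := by
  refine nonempty_equiv_directSum
    (s := fun E : {E : Diagram (k + m) // IsHorizontalStrip D.1 E.1 m} => sigma E.1)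
    (fun E => isIrreducible_sigma E.1)
    (fun E F h => Subtype.ext (eq_of_nonempty_equiv (E := E.1) (F := F.1) h)) (pieriInd D m)
    (fun E => ?_) ?_
  · by_contra! h
    have h1 := ip_chr (sigma E.1) (pieriInd D m)
    have : Subsingleton (IntertwiningMap (sigma E.1) (pieriInd D m)) :=
      ⟨fun f g => (h f).trans (h g).symm⟩
    rw [Module.finrank_zero_of_subsingleton, chr_pieriInd_eq_sum, map_sum] at h1
    simp [ip_chr_sigma, Subtype.coe_inj] at h1
  · have h1 := congrFun (chr_pieriInd_eq_sum D m) 1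
    rw [chr_one, Finset.sum_apply] at h1
    simp only [chr_one] at h1
    exact_mod_cast h1

end Pieri

end PieriSn

theorem mainTheorem2 (k m : ℕ) (D : PieriSn.Diagram k) :
    (PieriSn.sigma D).IsIrreducible ∧
    (∀ E : PieriSn.Diagram (k + m), (PieriSn.sigma E).IsIrreducible) ∧
    (∀ E F : PieriSn.Diagram (k + m), Nonempty ((PieriSn.sigma E).Equiv (PieriSn.sigma F)) → E = F) ∧
    PieriSn.IsMultiplicityFree (PieriSn.pieriInd D m) ∧
    Nonempty ((PieriSn.pieriInd D m).Equiv
      (Representation.directSum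
        fun E : {E : PieriSn.Diagram (k + m) // PieriSn.IsHorizontalStrip D.1 E.1 m} => PieriSn.sigma E.1)) := by
  refine ⟨PieriSn.isIrreducible_sigma D, fun E => PieriSn.isIrreducible_sigma E,
    fun E F => PieriSn.eq_of_nonempty_equiv, ?_, PieriSn.nonempty_pieriInd_equiv D m⟩
  obtain ⟨e⟩ := PieriSn.nonempty_pieriInd_equiv D m
  exact .congr e (PieriSn.isMultiplicityFree_directSum (fun E => PieriSn.isIrreducible_sigma E.1)
    fun E F h => Subtype.ext (PieriSn.eq_of_nonempty_equiv h))
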